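/- **The reduced chain.** Let $\mathbf V\in\mathbb Z_{\ge0}^{d\times n}$ have distinct columns, let $\mathbf c\in\mathbb Z_{\ge0}^d$ and $m,k\in\mathbb N$. Let $\mathcal X=\{\mathbf x\in\mathbb Z_{\ge0}^n:\mathbf V\mathbf x=\mathbf c,\ \|\mathbf x\|_1=m\}$ be the set of solutions with $m$ elements, and let $\pi$ be the uniform distribution on $\mathcal X$ (extended by $0$ to $\mathbb Z_{\ge0}^n\setminus\mathcal X$). For $\mathbf x,\mathbf x'\in\mathcal X$ let $\mathcal A(\mathbf x,\mathbf x')$ be the set of pairs $(\mathbf z,\mathbf z')\in\mathbb Z_{\ge0}^n\times\mathbb Z_{\ge0}^n$ with $\|\mathbf z\|_1=\|\mathbf z'\|_1=k$, $\mathbf V\mathbf z=\mathbf V\mathbf z'$ and $\mathbf x-\mathbf z=\mathbf x'-\mathbf z'\ge\mathbf 0$ entrywise, and let $\mathcal Z(\mathbf z)=\{\mathbf z'\in\mathbb Z_{\ge0}^n:\|\mathbf z'\|_1=k,\ \mathbf V\mathbf z'=\mathbf V\mathbf z\}$. The reduced chain with parameter $k$ is the Markov chain on $\mathcal X$ whose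 transition matrix $P_k$ is given, for $\mathbf x\neq\mathbf x'$, by $$P_k(\mathbf x,\mathbf x')=\frac1{2\binom mk}\sum_{(\mathbf z,\mathbf z')\in\mathcal A(\mathbf x,\mathbf x')}\frac{\pi(\mathbf x')}{\sum_{\mathbf z''\in\mathcal Z(\mathbf z)}\pi(\mathbf x-\mathbf z+\mathbf z'')}$$ if $\mathbf x,\mathbf x'$ differ in between $2$ and $2k$ entries, by $P_k(\mathbf x,\mathbf x')=0$ otherwise, and by $P_k(\mathbf x,\mathbf x)=1-\sum_{\mathbf x''\ne\mathbf x}P_k(\mathbf x,\mathbf x'')$. Its relaxation time is $\tau_{\mathrm{rel}}=1/(1-\lambda_2)\in(0,\infty]$, where $\lambda_2$ is the second largest eigenvalue of $P_k$, counted with multiplicity ($\tau_{\mathrm{rel}}=\infty$ if $\lambda_2=1$). **The instances.** For $\ell\ge3$ let $\mathbf M_\ell$ be the matrix with columns $\ell(\mathbf e_i+\mathbf e_j)$, $1\le i\le j\le\ell$; let $\mathbf S_\ell$ be the $\ell\times(\ell-2)$ matrix whose $i$th column has its first $i+1$ entries equal to $2\ell$ and the others equal to $0$; let $\mathbf T_\ell$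 be the $\ell\times(2\ell-1)$ matrix whose $i$th column has all entries equal to $i+1$; and put $\mathbf H_\ell=(\mathbf M_\ell\mid\mathbf 0\mid\mathbf S_\ell\mid\mathbf T_\ell)$, where $\mathbf 0$ is a single zero column. Let $$\mathbf V_\ell=\begin{pmatrix}\mathbf H_\ell&\mathbf 1&\mathbf 1\\ \mathbf 1&\mathbf 1&\mathbf H_\ell\end{pmatrix},$$ where each $\mathbf 1$ is an all-ones block and the middle block column is a single column; let $\mathbf c_\ell=(2\ell,\dots,2\ell)\in\mathbb Z_{\ge0}^{2\ell}$, $m=2\ell$ and $k=2$. **Lemma.** (a) For every odd $\ell\ge3$ the reduced chain of $(\mathbf V_\ell,\mathbf c_\ell,\pi)$ with $k=2$ is connected (irreducible). (b) The relaxation time of the reduced chain of $(\mathbf V_\ell,\mathbf c_\ell,\pi)$ with $k=2$ is $\Omega\big((\ell/e)^\ell\big)$: there is a constant $C>0$ such that $\tau_{\mathrm{rel}}\ge C(\ell/e)^\ell$ for every $\ell\ge3$. In particular the instances with $\ell$ odd form an explicit family with a connected reduced chain and relaxation time $\Omega\big((\ell/e)^\ell\big)$. -/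

import Mathlib

open scoped ENNReal Matrix

noncomputable section

namespace ReducedChain

variable {d ι : Type*} [Fintype d] [DecidableEq d] [Fintype ι] [DecidableEq ι]

/-- The multisets with `k` elements over the columns `ι`, written as vectors of multiplicities. -/
def multisets (ι : Type*) [Fintype ι] [DecidableEq ι] (k : ℕ) : Finset (ι → ℕ) :=
  Finset.piAntidiag Finset.univ k

/-- The solutions of the instance `(V, c)` with `m` elements: the vectors `x` of multiplicities
with `V x = c` and `‖x‖₁ = m`. -/
def solutions (V : Matrix d ι ℕ) (c : d → ℕ) (m : ℕ) : Finset (ι → ℕ) :=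
  (multisets ι m).filter fun x => V *ᵥ x = c

/-- The uniform distribution on the solutions (and `0` on all other multisets). -/
def uniformDist (V : Matrix d ι ℕ) (c : d → ℕ) (m : ℕ) (x : ι → ℕ) : ℝ :=
  if x ∈ solutions V c m then 1 / ((solutions V c m).card : ℝ) else 0

/-- The pairs `(z, z')` of multisets of size `k` with equal sums such that removing `z` from `x`
and adding `z'` gives `x'`. -/
def swaps (V : Matrix d ι ℕ) (k : ℕ) (x x' : ι → ℕ) : Finset ((ι → ℕ) × (ι → ℕ)) :=
  (multisets ι k ×ˢ multisets ι k).filter fun p =>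
    V *ᵥ p.1 = V *ᵥ p.2 ∧ (∀ i, p.1 i ≤ x i) ∧ (∀ i, p.2 i ≤ x' i) ∧ x - p.1 = x' - p.2

/-- The multisets of size `k` with the same sum as `z`. -/
def replacements (V : Matrix d ι ℕ) (k : ℕ) (z : ι → ℕ) : Finset (ι → ℕ) :=
  (multisets ι k).filter fun z' => V *ᵥ z' = V *ᵥ z

/-- The probability that the reduced chain moves from `x` to a different solution `x'`. -/
def moveProb (V : Matrix d ι ℕ) (m k : ℕ) (π : (ι → ℕ) → ℝ) (x x' : ι → ℕ) : ℝ :=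
  if 2 ≤ hammingDist x x' ∧ hammingDist x x' ≤ 2 * k then
    1 / (2 * (m.choose k : ℝ)) *
      ∑ p ∈ swaps V k x x', π x' / ∑ z ∈ replacements V k p.1, π (x - p.1 + z)
  else 0

/-- The transition matrix of the reduced chain with parameter `k` and target distribution `π`, on
the solutions of `(V, c)` with `m` elements. -/
def transition (V : Matrix d ι ℕ) (c : d → ℕ) (m k : ℕ) (π : (ι → ℕ) → ℝ) :
    Matrix (solutions V c m) (solutions V c m) ℝ :=
  Matrix.of fun x x' =>
    if x = x' then 1 - ∑ y ∈ Finset.univ.erase x, moveProb V m k π x.1 y.1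
    else moveProb V m k π x.1 x'.1

/-- The second largest eigenvalue, counted with multiplicity, of a square real matrix with real
eigenvalues (`0` if there is no second eigenvalue). -/
def secondEigenvalue {α : Type*} [Fintype α] [DecidableEq α] (P : Matrix α α ℝ) : ℝ :=
  (P.charpoly.roots.sort (· ≥ ·)).getD 1 0

/-- The relaxation time `1 / (1 - λ₂)` of a transition matrix; it is `∞` if `λ₂ = 1`. -/
def relaxationTime {α : Type*} [Fintype α] [DecidableEq α] (P : Matrix α α ℝ) : ℝ≥0∞ :=
  1 / ENNReal.ofReal (1 - secondEigenvalue P)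

/-- The columns are the vectors `ℓ (e_i + e_j)`, one for each unordered pair `{i, j}`, where
`i = j` is allowed. -/
def matM (ℓ : ℕ) : Matrix (Fin ℓ) (Sym2 (Fin ℓ)) ℕ :=
  Matrix.of fun r s =>
    Sym2.lift ⟨fun i j => ℓ * ((Pi.single i 1 + Pi.single j 1 : Fin ℓ → ℕ) r),
      fun _ _ => by simp [add_comm]⟩ s

/-- Column number `i` (counted from `0`) has `2 ℓ` in its first `i + 2` entries and `0`
elsewhere. -/
def matS (ℓ : ℕ) : Matrix (Fin ℓ) (Fin (ℓ - 2)) ℕ :=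
  Matrix.of fun r i => if r.val < i.val + 2 then 2 * ℓ else 0

/-- Column number `i` (counted from `0`) has `i + 2` in every entry. -/
def matT (ℓ : ℕ) : Matrix (Fin ℓ) (Fin (2 * ℓ - 1)) ℕ :=
  Matrix.of fun _ i => i.val + 2

/-- Indices of the columns of `(M | 0 | S | T)`. -/
abbrev HalfCol (ℓ : ℕ) : Type :=
  Sym2 (Fin ℓ) ⊕ (Unit ⊕ (Fin (ℓ - 2) ⊕ Fin (2 * ℓ - 1)))

instance (ℓ : ℕ) : DecidableEq (HalfCol ℓ) := inferInstance

/-- The block matrix `(M | 0 | S | T)`. -/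
def half (ℓ : ℕ) : Matrix (Fin ℓ) (HalfCol ℓ) ℕ :=
  Matrix.fromCols (matM ℓ) (Matrix.fromCols 0 (Matrix.fromCols (matS ℓ) (matT ℓ)))

/-- The matrix with all entries `1`. -/
def ones (α β : Type*) : Matrix α β ℕ := Matrix.of fun _ _ => 1

/-- Indices of the columns of `exV`. -/
abbrev ExCol (ℓ : ℕ) : Type := HalfCol ℓ ⊕ (Unit ⊕ HalfCol ℓ)

/-- The matrix with rows `(M 0 S T | 1 | 1)` and `(1 | 1 | M 0 S T)`. -/
def exV (ℓ : ℕ) : Matrix (Fin ℓ ⊕ Fin ℓ) (ExCol ℓ) ℕ :=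
  Matrix.fromCols (Matrix.fromRows (half ℓ) (ones _ _))
    (Matrix.fromCols (ones _ _) (Matrix.fromRows (ones _ _) (half ℓ)))

/-- The target vector, with all entries `2 ℓ`. -/
def exC (ℓ : ℕ) : Fin ℓ ⊕ Fin ℓ → ℕ := fun _ => 2 * ℓ

/-- The reduced chain with `k = 2` for `exV`, `exC` and the uniform distribution, on the solutions
with `2 ℓ` elements. -/
def exP (ℓ : ℕ) :
    Matrix (solutions (exV ℓ) (exC ℓ) (2 * ℓ)) (solutions (exV ℓ) (exC ℓ) (2 * ℓ)) ℝ :=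
  transition (exV ℓ) (exC ℓ) (2 * ℓ) 2 (uniformDist (exV ℓ) (exC ℓ) (2 * ℓ))

end ReducedChain

end

/-! Connectedness. `P` is symmetric with nonnegative entries and positive diagonal, so it suffices
to lower a potential from every solution except `allMid` (`isIrreducible_of_descent`). Subtracting
the cardinality equation from a top row equation shows that the `a` left columns of a solution sum
to `a` in every top row; the right block is symmetric. In such a half, two edges (columns of `M`) at
a common vertex yield a loop and another edge or loop, loops are absorbed one by one into a column
of `S` and finally into a column of `T`, and a column of `T` together with a zero column unwinds
into all-ones columns (`canDescend`). Oddness of `ℓ` enters only to force `a = 2ℓ` when no column of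
`T` is present.

Slow mixing. Cut the solutions into the graphical ones (only `M`, `0`, `S` on the left) and the
rest. For `ℓ ≥ 5` a single pair of columns allows an exit, and a single graphical solution contains
it (`eq_exitPair`, `eq_exitSolution`), so the flow across the cut is at most `1 / (2 * (2ℓ).choose
2)`. Hamiltonian cycles padded with zero columns give at least `(ℓ-2)!` graphical solutions, and
exchanging the two blocks shows that the complement is no smaller. The easy Cheeger-type bound
`one_sub_secondEigenvalue_mul_le` then gives `1 - λ₂ ≤ 1 / ℓ!`, and `ℓ! ≥ (ℓ/e)^ℓ`. The cases `ℓ =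
3, 4` are absorbed into the constant. -/

namespace ReducedChain

/-! ### Second eigenvalue and cuts of a symmetric stochastic matrix. -/

section Spectral

variable {α : Type*} [Fintype α] [DecidableEq α]

theorem secondEigenvalue_eq_eigenvalues₀ {P : Matrix α α ℝ} (hP : P.IsHermitian)
    (h : 1 < Fintype.card α) : secondEigenvalue P = hP.eigenvalues₀ ⟨1, h⟩ := by
  have h1 := hP.sort_roots_charpoly_eq_eigenvalues₀
  have h2 : P.charpoly.roots.map (RCLike.re : ℝ → ℝ) = P.charpoly.roots := by
    convert Multiset.map_id _ using 2
    simp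
  rw [h2] at h1
  rw [secondEigenvalue, h1, List.getD_eq_getElem _ _ (by simpa using h)]
  simp

/-- On the orthogonal complement of a suitable vector, the quadratic form of a symmetric matrix is
bounded by its second largest eigenvalue. -/
theorem exists_forall_dotProduct_mulVec_le {P : Matrix α α ℝ} (hP : P.IsHermitian)
    (h : 1 < Fintype.card α) :
    ∃ v : α → ℝ, ∀ f : α → ℝ, v ⬝ᵥ f = 0 → f ⬝ᵥ P *ᵥ f ≤ secondEigenvalue P * (f ⬝ᵥ f) := by
  have hpos : 0 < Fintype.card α := by omega
  let e : Fin (Fintype.card α) ≃ α := Fintype.equivOfCardEq (Fintype.card_fin _)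
  let b := hP.eigenvectorBasis
  have hle : ∀ i, i ≠ e ⟨0, hpos⟩ → hP.eigenvalues i ≤ secondEigenvalue P := by
    intro i hi
    rw [secondEigenvalue_eq_eigenvalues₀ hP h]
    apply hP.eigenvalues₀_antitone
    rw [Fin.le_def]
    change 1 ≤ (e.symm i).val
    by_contra hlt
    apply hi
    rw [← e.symm_apply_eq, Fin.ext_iff]
    simp only
    omega
  have hinner : ∀ f g : α → ℝ, f ⬝ᵥ g = ∑ i, (b i ⬝ᵥ f) * (b i ⬝ᵥ g) := by
    intro f g
    have := b.sum_inner_mul_inner (WithLp.toLp 2 f) (WithLp.toLp 2 g)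
    simp only [EuclideanSpace.inner_eq_star_dotProduct, star_trivial] at this
    rw [dotProduct_comm f g, ← this]
    refine Finset.sum_congr rfl fun i _ => ?_
    rw [dotProduct_comm (b i) g]
  -- The suitable vector is the top eigenvector: orthogonality to it removes the only term of the
  -- eigenbasis expansion whose eigenvalue may exceed the second one.
  refine ⟨b (e ⟨0, hpos⟩), fun f hf => ?_⟩
  rw [hinner f (P *ᵥ f), hinner f f, Finset.mul_sum]
  refine Finset.sum_le_sum fun i _ => ?_
  have h1 : (b i : α → ℝ) ⬝ᵥ P *ᵥ f = hP.eigenvalues i * (b i ⬝ᵥ f) := by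
    have hT : Pᵀ = P := show P.IsSymm by simpa using hP
    rw [Matrix.dotProduct_mulVec, ← Matrix.mulVec_transpose, hT]
    have := hP.mulVec_eigenvectorBasis i
    change P *ᵥ (b i : α → ℝ) = _ at this
    rw [this, smul_dotProduct, smul_eq_mul]
  rw [h1]
  by_cases hi : i = e ⟨0, hpos⟩
  · rw [hi, hf]; simp
  · nlinarith [hle i hi, mul_self_nonneg ((b i : α → ℝ) ⬝ᵥ f)]

/-- The spectral gap of a symmetric stochastic matrix is bounded by the flow across any cut. -/
theorem one_sub_secondEigenvalue_mul_le {P : Matrix α α ℝ} (hP : P.IsHermitian)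
    (hrow : ∀ x, ∑ y, P x y = 1) (U : Finset α) (hU : U.Nonempty) (hUc : Uᶜ.Nonempty)
    (hQ : 0 ≤ ∑ x ∈ U, ∑ y ∈ Uᶜ, P x y) :
    (1 - secondEigenvalue P) * (U.card * Uᶜ.card) ≤
      (∑ x ∈ U, ∑ y ∈ Uᶜ, P x y) * (U.card + Uᶜ.card) := by
  set Q := ∑ x ∈ U, ∑ y ∈ Uᶜ, P x y with hQdef
  have hT : Pᵀ = P := show P.IsSymm by simpa using hP
  have hn : (0 : ℝ) < U.card := by exact_mod_cast hU.card_pos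
  have hn' : (0 : ℝ) < Uᶜ.card := by exact_mod_cast hUc.card_pos
  have hcard : U.card + Uᶜ.card = Fintype.card α := Finset.card_add_card_compl U
  have hcard2 : (Fintype.card α : ℝ) = U.card + Uᶜ.card := by exact_mod_cast hcard.symm
  have h1 : 1 < Fintype.card α := by
    have := hU.card_pos
    have := hUc.card_pos
    omega
  obtain ⟨v, hv⟩ := exists_forall_dotProduct_mulVec_le hP h1
  let u : α → ℝ := fun x => if x ∈ U then 1 else 0
  -- The span of `1` and the indicator `u` of `U` contains a nonzero test function orthogonal to
  -- `v`, so `v` need not be identified with the constant vector.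
  obtain ⟨a, b, hab, h0⟩ : ∃ a b : ℝ, (a ≠ 0 ∨ b ≠ 0) ∧ a * (v ⬝ᵥ 1) + b * (v ⬝ᵥ u) = 0 := by
    by_cases hs : v ⬝ᵥ (1 : α → ℝ) = 0
    · exact ⟨1, 0, by simp, by simp [hs]⟩
    · exact ⟨v ⬝ᵥ u, -(v ⬝ᵥ 1), by simp [hs], by ring⟩
  have hP1 : P *ᵥ (1 : α → ℝ) = 1 := by
    ext x
    simp [Matrix.mulVec, dotProduct, hrow]
  have h11 : (1 : α → ℝ) ⬝ᵥ 1 = U.card + Uᶜ.card := by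
    rw [← hcard2]; simp
  have h1u : (1 : α → ℝ) ⬝ᵥ u = U.card := by simp [dotProduct, u]
  have huu : u ⬝ᵥ u = U.card := by simp [dotProduct, u]
  have huPu : u ⬝ᵥ P *ᵥ u = U.card - Q := by
    have : ∀ x ∈ U, ∑ y ∈ Uᶜ, P x y = 1 - ∑ y ∈ U, P x y := fun x _ => by
      rw [← hrow x, ← Finset.sum_add_sum_compl U]; ring
    rw [hQdef, Finset.sum_congr rfl this]
    simp [dotProduct, Matrix.mulVec, u, Finset.sum_sub_distrib]
  have h1Pu : (1 : α → ℝ) ⬝ᵥ P *ᵥ u = U.card := by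
    rw [Matrix.dotProduct_mulVec, ← Matrix.mulVec_transpose, hT, hP1, h1u]
  have huP1 : u ⬝ᵥ P *ᵥ (1 : α → ℝ) = U.card := by rw [hP1, dotProduct_comm, h1u]
  have key := hv (a • 1 + b • u) (by simpa [dotProduct_add] using h0)
  simp only [Matrix.mulVec_add, Matrix.mulVec_smul, dotProduct_add, add_dotProduct,
    smul_dotProduct, dotProduct_smul, smul_eq_mul, h1Pu, huPu, huP1, h1u, huu,
    dotProduct_comm u 1, h11] at key
  rw [show (1 : α → ℝ) ⬝ᵥ P *ᵥ 1 = U.card + Uᶜ.card by rw [hP1, h11]] at key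
  generalize (U.card : ℝ) = n at *
  generalize (Uᶜ.card : ℝ) = n' at *
  generalize secondEigenvalue P = s at *
  by_cases hs : 1 - s ≤ 0
  · have : (1 - s) * (n * n') ≤ 0 := mul_nonpos_of_nonpos_of_nonneg hs (by positivity)
    have : 0 ≤ Q * (n + n') := by positivity
    linarith
  push Not at hs
  -- The test function `f` is `a` off `U` and `a + b` on `U`; its Dirichlet form `f ⬝ᵥ f - f ⬝ᵥ P *ᵥ
  -- f` equals `b ^ 2 * Q`.
  have key2 : (1 - s) * (a ^ 2 * n' + (a + b) ^ 2 * n) ≤ b ^ 2 * Q := by linarith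
  have hb : b ≠ 0 := by
    rintro rfl
    have ha : a ≠ 0 := by simpa using hab
    have : 0 < (1 - s) * (a ^ 2 * n' + (a + 0) ^ 2 * n) := by positivity
    linarith
  have hb2 : 0 < b ^ 2 := by positivity
  -- Variance identity: the two sides differ by exactly `(a * n' + (a + b) * n) ^ 2`.
  have h3 : b ^ 2 * (n * n') ≤ (a ^ 2 * n' + (a + b) ^ 2 * n) * (n + n') := by
    nlinarith [sq_nonneg (a * n' + (a + b) * n)]
  refine le_of_mul_le_mul_left ?_ hb2
  calc b ^ 2 * ((1 - s) * (n * n')) = (1 - s) * (b ^ 2 * (n * n')) := by ring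
    _ ≤ (1 - s) * ((a ^ 2 * n' + (a + b) ^ 2 * n) * (n + n')) := by gcongr
    _ = ((1 - s) * (a ^ 2 * n' + (a + b) ^ 2 * n)) * (n + n') := by ring
    _ ≤ (b ^ 2 * Q) * (n + n') := by gcongr
    _ = b ^ 2 * (Q * (n + n')) := by ring

end Spectral

/-! ### General properties of the reduced chain: symmetry, laziness, flow bounds. -/

section Chain

variable {d ι : Type*} [Fintype d] [Fintype ι] [DecidableEq ι]

theorem mem_multisets {k : ℕ} {x : ι → ℕ} : x ∈ multisets ι k ↔ ∑ i, x i = k := by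
  simp [multisets]

theorem mem_solutions {V : Matrix d ι ℕ} {c : d → ℕ} {m : ℕ} {x : ι → ℕ} :
    x ∈ solutions V c m ↔ ∑ i, x i = m ∧ V *ᵥ x = c := by
  simp [solutions, mem_multisets]

theorem mem_swaps {V : Matrix d ι ℕ} {k : ℕ} {x x' : ι → ℕ} {p : (ι → ℕ) × (ι → ℕ)} :
    p ∈ swaps V k x x' ↔ (∑ i, p.1 i = k ∧ ∑ i, p.2 i = k) ∧ V *ᵥ p.1 = V *ᵥ p.2 ∧
      (∀ i, p.1 i ≤ x i) ∧ (∀ i, p.2 i ≤ x' i) ∧ x - p.1 = x' - p.2 := by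
  simp [swaps, mem_multisets]

theorem mem_replacements {V : Matrix d ι ℕ} {k : ℕ} {z z' : ι → ℕ} :
    z' ∈ replacements V k z ↔ ∑ i, z' i = k ∧ V *ᵥ z' = V *ᵥ z := by
  simp [replacements, mem_multisets]

theorem uniformDist_nonneg (V : Matrix d ι ℕ) (c : d → ℕ) (m : ℕ) (x : ι → ℕ) :
    0 ≤ uniformDist V c m x := by
  rw [uniformDist]; split_ifs <;> positivity

theorem uniformDist_pos {V : Matrix d ι ℕ} {c : d → ℕ} {m : ℕ} {x : ι → ℕ}
    (hx : x ∈ solutions V c m) : 0 < uniformDist V c m x := by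
  rw [uniformDist, if_pos hx]
  have : 0 < (solutions V c m).card := Finset.card_pos.mpr ⟨x, hx⟩
  positivity

theorem uniformDist_eq {V : Matrix d ι ℕ} {c : d → ℕ} {m : ℕ} {x y : ι → ℕ}
    (hx : x ∈ solutions V c m) (hy : y ∈ solutions V c m) :
    uniformDist V c m x = uniformDist V c m y := by
  rw [uniformDist, uniformDist, if_pos hx, if_pos hy]

theorem add_eq_of_mem_swaps {V : Matrix d ι ℕ} {k : ℕ} {x x' : ι → ℕ}
    {p : (ι → ℕ) × (ι → ℕ)} (hp : p ∈ swaps V k x x') : x - p.1 + p.2 = x' := by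
  obtain ⟨-, -, -, h2, h3⟩ := mem_swaps.mp hp
  rw [h3]
  exact tsub_add_cancel_of_le h2

variable (V : Matrix d ι ℕ) (c : d → ℕ) (m k : ℕ)

/-- Reversing a swap `(z, z')` keeps the remainder `x - z = y - z'` and the set of replacements,
hence the denominator; the numerators agree because the distribution is uniform. -/
theorem moveProb_comm {x y : ι → ℕ} (hx : x ∈ solutions V c m) (hy : y ∈ solutions V c m) :
    moveProb V m k (uniformDist V c m) x y = moveProb V m k (uniformDist V c m) y x := by
  rw [moveProb, moveProb, hammingDist_comm x y]
  congr 2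
  refine Finset.sum_bij' (fun p _ => p.swap) (fun p _ => p.swap) ?_ ?_ (by simp) (by simp) ?_
  · intro p hp
    rw [mem_swaps] at hp ⊢
    exact ⟨hp.1.symm, hp.2.1.symm, hp.2.2.2.1, hp.2.2.1, hp.2.2.2.2.symm⟩
  · intro p hp
    rw [mem_swaps] at hp ⊢
    exact ⟨hp.1.symm, hp.2.1.symm, hp.2.2.2.1, hp.2.2.1, hp.2.2.2.2.symm⟩
  · intro p hp
    rw [mem_swaps] at hp
    simp only [Prod.fst_swap]
    rw [uniformDist_eq hx hy, hp.2.2.2.2, replacements, replacements, hp.2.1]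

theorem moveProb_nonneg {π : (ι → ℕ) → ℝ} (hπ : ∀ x, 0 ≤ π x) (x y : ι → ℕ) :
    0 ≤ moveProb V m k π x y := by
  rw [moveProb]
  split_ifs
  · refine mul_nonneg (by positivity) (Finset.sum_nonneg fun p _ => ?_)
    exact div_nonneg (hπ _) (Finset.sum_nonneg fun z _ => hπ _)
  · rfl

/-- The probability of moving from `x` into `Y` is bounded by the number of multisets `z ⊆ x`
whose replacement can lead into `Y`. -/
theorem sum_moveProb_le {π : (ι → ℕ) → ℝ} (hπ : ∀ x, 0 ≤ π x) (x : ι → ℕ)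
    (Y Z : Finset (ι → ℕ)) (hZ : ∀ y ∈ Y, ∀ p ∈ swaps V k x y, p.1 ∈ Z) :
    ∑ y ∈ Y, moveProb V m k π x y ≤ 1 / (2 * (m.choose k : ℝ)) * Z.card := by
  let g : (ι → ℕ) × (ι → ℕ) → ℝ :=
    fun p => π (x - p.1 + p.2) / ∑ z ∈ replacements V k p.1, π (x - p.1 + z)
  have hg : ∀ p, 0 ≤ g p := fun p => div_nonneg (hπ _) (Finset.sum_nonneg fun z _ => hπ _)
  have h1 : ∀ y ∈ Y, moveProb V m k π x y ≤
      1 / (2 * (m.choose k : ℝ)) * ∑ p ∈ swaps V k x y, g p := by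
    intro y _
    have heq : ∑ p ∈ swaps V k x y, g p = ∑ p ∈ swaps V k x y,
        π y / ∑ z ∈ replacements V k p.1, π (x - p.1 + z) :=
      Finset.sum_congr rfl fun p hp => by simp only [g, add_eq_of_mem_swaps hp]
    rw [moveProb]
    split_ifs
    · rw [heq]
    · exact mul_nonneg (by positivity) (Finset.sum_nonneg fun p _ => hg p)
  refine (Finset.sum_le_sum h1).trans ?_
  rw [← Finset.mul_sum]
  refine mul_le_mul_of_nonneg_left ?_ (by positivity)
  -- A swap determines its endpoint `x - z + z'`, so the swap sets of different `y` are disjoint.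
  rw [← Finset.sum_biUnion]
  · calc ∑ p ∈ Y.biUnion fun y => swaps V k x y, g p
        ≤ ∑ p ∈ (Z ×ˢ multisets ι k).filter (fun p => V *ᵥ p.2 = V *ᵥ p.1), g p := by
          refine Finset.sum_le_sum_of_subset_of_nonneg (fun p hp => ?_) fun p _ _ => hg p
          obtain ⟨y, hy, hp⟩ := Finset.mem_biUnion.mp hp
          have hp' := mem_swaps.mp hp
          exact Finset.mem_filter.mpr ⟨Finset.mem_product.mpr
            ⟨hZ y hy p hp, mem_multisets.mpr hp'.1.2⟩, hp'.2.1.symm⟩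
      _ = ∑ z ∈ Z, ∑ z' ∈ replacements V k z, g (z, z') := by
          rw [Finset.sum_filter, Finset.sum_product]
          exact Finset.sum_congr rfl fun z _ => by rw [replacements, Finset.sum_filter]
      _ ≤ ∑ z ∈ Z, (1 : ℝ) := by
          refine Finset.sum_le_sum fun z _ => ?_
          simp only [g]
          rw [← Finset.sum_div]
          -- For fixed `z` the weights sum to `1`, or to `0` if the denominator vanishes.
          exact div_self_le_one _
      _ = Z.card := by simp
  · intro y _ y' _ hne
    refine Finset.disjoint_left.mpr fun p hp hp' => hne ?_
    rw [← add_eq_of_mem_swaps hp, add_eq_of_mem_swaps hp']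

/-- `Multiset.powersetCard` lists the `m.choose k` selections with repetition; distinct submultisets
are at most as many. -/
theorem card_submultisets_le {x : ι → ℕ} (hx : ∑ i, x i = m) :
    ((multisets ι k).filter fun z => ∀ i, z i ≤ x i).card ≤ m.choose k := by
  let toM : (ι → ℕ) → Multiset ι := fun z => ∑ i, z i • {i}
  have hcount : ∀ z j, (toM z).count j = z j := by
    intro z j
    simp [toM, Multiset.count_sum', Multiset.count_singleton]
  have hcard : ∀ z, (toM z).card = ∑ i, z i := by
    intro z
    simp [toM, Multiset.card_sum]
  calc ((multisets ι k).filter fun z => ∀ i, z i ≤ x i).card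
      ≤ (Multiset.powersetCard k (toM x)).toFinset.card := by
        refine Finset.card_le_card_of_injOn toM (fun z hz => ?_) fun z _ z' _ h => ?_
        · simp only [Finset.coe_filter, mem_multisets, Set.mem_ofPred_eq] at hz
          rw [Finset.mem_coe, Multiset.mem_toFinset, Multiset.mem_powersetCard, hcard]
          refine ⟨Multiset.le_iff_count.mpr fun j => ?_, hz.1⟩
          rw [hcount, hcount]
          exact hz.2 j
        · ext j
          rw [← hcount z, ← hcount z', h]
    _ ≤ (Multiset.powersetCard k (toM x)).card := Multiset.toFinset_card_le _
    _ = m.choose k := by rw [Multiset.card_powersetCard, hcard, hx]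

variable {m k} in
theorem two_le_hammingDist {x y : ι → ℕ} (hxy : x ≠ y) (h : ∑ i, x i = ∑ i, y i) :
    2 ≤ hammingDist x y := by
  by_contra hlt
  obtain ⟨i, hi⟩ := Function.ne_iff.mp hxy
  have hle : (Finset.univ.filter fun i => x i ≠ y i).card ≤ 1 := by
    rw [hammingDist] at hlt
    omega
  have hj : ∀ j, j ≠ i → x j = y j := by
    intro j hj
    by_contra hne
    exact hj (Finset.card_le_one.mp hle j (by simpa using hne) i (by simpa using hi))
  rw [← Finset.add_sum_erase _ _ (Finset.mem_univ i),
    ← Finset.add_sum_erase _ y (Finset.mem_univ i),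
    Finset.sum_congr rfl fun j hj' => hj j (Finset.ne_of_mem_erase hj')] at h
  exact hi (Nat.add_right_cancel h)

omit [DecidableEq ι] in
theorem card_support_le_sum (z : ι → ℕ) :
    (Finset.univ.filter fun i => z i ≠ 0).card ≤ ∑ i, z i := by
  rw [Finset.card_filter]
  exact Finset.sum_le_sum fun i _ => by split_ifs <;> omega

theorem hammingDist_add_le (y z z' : ι → ℕ) :
    hammingDist (y + z) (y + z') ≤ ∑ i, z i + ∑ i, z' i := by
  refine le_trans ?_ (add_le_add (card_support_le_sum z) (card_support_le_sum z'))
  refine le_trans (Finset.card_le_card fun i hi => ?_) (Finset.card_union_le _ _)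
  simp only [Finset.mem_filter, Finset.mem_univ, true_and, Finset.mem_union, Pi.add_apply] at hi ⊢
  by_contra! h
  rw [h.1, h.2] at hi
  exact hi rfl

variable {V c m k} in
theorem add_mem_solutions {y z z' : ι → ℕ} (h : y + z ∈ solutions V c m)
    (hsum : ∑ i, z i = ∑ i, z' i) (hV : V *ᵥ z = V *ᵥ z') : y + z' ∈ solutions V c m := by
  rw [mem_solutions] at h ⊢
  simp only [Pi.add_apply, Finset.sum_add_distrib, Matrix.mulVec_add] at h ⊢
  rw [← hsum, ← hV]
  exact h

variable {V c m k} in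
theorem moveProb_pos {y z z' : ι → ℕ} (h : y + z ∈ solutions V c m) (hz : ∑ i, z i = k)
    (hz' : ∑ i, z' i = k) (hV : V *ᵥ z = V *ᵥ z') (hne : z ≠ z') :
    0 < moveProb V m k (uniformDist V c m) (y + z) (y + z') := by
  have h' : y + z' ∈ solutions V c m := add_mem_solutions h (hz.trans hz'.symm) hV
  have hkm : k ≤ m := by
    rw [← (mem_solutions.mp h).1, ← hz]
    exact Finset.sum_le_sum fun i _ => by simp
  rw [moveProb, if_pos]
  · have : 0 < m.choose k := Nat.choose_pos hkm
    refine mul_pos (by positivity) (Finset.sum_pos (fun p hp => ?_) ⟨(z, z'), ?_⟩)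
    · refine div_pos (uniformDist_pos h') ?_
      refine Finset.sum_pos' (fun z _ => uniformDist_nonneg _ _ _ _) ⟨p.2, ?_, ?_⟩
      · rw [mem_swaps] at hp
        exact mem_replacements.mpr ⟨hp.1.2, hp.2.1.symm⟩
      · rw [add_eq_of_mem_swaps hp]
        exact uniformDist_pos h'
    · rw [mem_swaps]
      refine ⟨⟨hz, hz'⟩, hV, fun i => by simp, fun i => by simp, by simp⟩
  · refine ⟨two_le_hammingDist (by simpa using hne) ?_, ?_⟩
    · rw [(mem_solutions.mp h).1, (mem_solutions.mp h').1]
    · have := hammingDist_add_le y z z'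
      omega

/-- The factor `1/2` makes the chain lazy: at most `m.choose k` choices of `z` contribute to the
probability of leaving `x`. -/
theorem transition_diag_ge (hm : k ≤ m) (x : solutions V c m) :
    1 / 2 ≤ transition V c m k (uniformDist V c m) x x := by
  have hx := mem_solutions.mp x.2
  have h1 := sum_moveProb_le V m k (uniformDist_nonneg V c m) x.1
    ((Finset.univ.erase x).map (Function.Embedding.subtype _))
    ((multisets ι k).filter fun z => ∀ i, z i ≤ x.1 i) (fun y _ p hp => by
      rw [mem_swaps] at hp
      simp only [Finset.mem_filter, mem_multisets]
      exact ⟨hp.1.1, hp.2.2.1⟩)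
  rw [Finset.sum_map] at h1
  have h2 : (((multisets ι k).filter fun z => ∀ i, z i ≤ x.1 i).card : ℝ) ≤ m.choose k := by
    exact_mod_cast card_submultisets_le m k hx.1
  have h3 : (0 : ℝ) < m.choose k := by exact_mod_cast Nat.choose_pos hm
  have h4 : 1 / (2 * (m.choose k : ℝ)) *
      ((multisets ι k).filter fun z => ∀ i, z i ≤ x.1 i).card ≤ 1 / 2 := by
    rw [div_mul_eq_mul_div, one_mul, div_le_div_iff₀ (by positivity) (by norm_num)]
    linarith
  simp only [transition, Matrix.of_apply, if_true]
  simp only [Function.Embedding.subtype_apply] at h1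
  linarith

theorem transition_apply_ne (π : (ι → ℕ) → ℝ) {x y : solutions V c m} (h : x ≠ y) :
    transition V c m k π x y = moveProb V m k π x.1 y.1 := by
  simp [transition, h]

theorem transition_row_sum (π : (ι → ℕ) → ℝ) (x : solutions V c m) :
    ∑ y, transition V c m k π x y = 1 := by
  rw [← Finset.add_sum_erase _ _ (Finset.mem_univ x), Finset.sum_congr rfl fun y hy =>
    transition_apply_ne V c m k π (Finset.ne_of_mem_erase hy).symm]
  simp [transition]

theorem transition_isHermitian : (transition V c m k (uniformDist V c m)).IsHermitian := by
  refine Matrix.IsHermitian.ext fun x y => ?_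
  rw [star_trivial]
  by_cases h : x = y
  · rw [h]
  · rw [transition_apply_ne _ _ _ _ _ h, transition_apply_ne _ _ _ _ _ (Ne.symm h)]
    exact moveProb_comm V c m k y.2 x.2

theorem transition_nonneg (hm : k ≤ m) (x y : solutions V c m) :
    0 ≤ transition V c m k (uniformDist V c m) x y := by
  by_cases h : x = y
  · rw [h]
    linarith [transition_diag_ge V c m k hm y]
  · rw [transition_apply_ne _ _ _ _ _ h]
    exact moveProb_nonneg V m k (uniformDist_nonneg V c m) _ _

/-- The flow out of `U` is bounded by the number of pairs `(x, z)` of a solution `x ∈ U` and a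
multiset `z ⊆ x` whose replacement can lead out of `U`. -/
theorem flow_le (U : Finset (solutions V c m)) (E : (ι → ℕ) → Finset (ι → ℕ))
    (hE : ∀ x ∈ U, ∀ y ∉ U, ∀ p ∈ swaps V k x.1 y.1, p.1 ∈ E x.1) :
    ∑ x ∈ U, ∑ y ∈ Uᶜ, transition V c m k (uniformDist V c m) x y ≤
      1 / (2 * (m.choose k : ℝ)) * ∑ x ∈ U, ((E x.1).card : ℝ) := by
  rw [Finset.mul_sum]
  refine Finset.sum_le_sum fun x hx => ?_
  have h1 := sum_moveProb_le V m k (uniformDist_nonneg V c m) x.1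
    (Uᶜ.map (Function.Embedding.subtype _)) (E x.1) (fun y hy p hp => by
      simp only [Finset.mem_map, Finset.mem_compl, Function.Embedding.subtype_apply] at hy
      obtain ⟨y, hy, rfl⟩ := hy
      exact hE x hx y hy p hp)
  rw [Finset.sum_map] at h1
  refine le_of_eq_of_le (Finset.sum_congr rfl fun y hy => ?_) h1
  refine transition_apply_ne _ _ _ _ _ ?_
  rintro rfl
  exact Finset.mem_compl.mp hy hx

end Chain

/-! ### Irreducibility from a decreasing potential. -/

/-- A nonnegative symmetric matrix with positive diagonal is irreducible if a potential can be
decreased along its positive entries from every index but one. -/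
theorem isIrreducible_of_descent {α : Type*} {P : Matrix α α ℝ} (hP : ∀ x y, 0 ≤ P x y)
    (hdiag : ∀ x, 0 < P x x) (hsymm : ∀ x y, P x y = P y x) (w : α → ℕ) (x₀ : α)
    (hdesc : ∀ x, x ≠ x₀ → ∃ y, 0 < P x y ∧ w y < w x) : P.IsIrreducible := by
  have hto : ∀ n x, w x = n → Relation.ReflTransGen (fun x y => 0 < P x y) x x₀ := by
    intro n
    induction n using Nat.strong_induction_on with
    | _ n ih =>
      intro x hx
      by_cases h : x = x₀
      · rw [h]
      · obtain ⟨y, hxy, hy⟩ := hdesc x h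
        exact Relation.ReflTransGen.head hxy (ih (w y) (hx ▸ hy) y rfl)
  have hfrom : ∀ x, Relation.ReflTransGen (fun x y => 0 < P x y) x₀ x := by
    intro x
    have : Std.Symm fun x y => 0 < P x y := ⟨fun a b h => by rwa [hsymm]⟩
    exact symm (hto _ x rfl)
  refine ⟨hP, ?_⟩
  let _ := P.toQuiver
  have hpath : ∀ x y, Relation.ReflTransGen (fun x y => 0 < P x y) x y →
      Nonempty (Quiver.Path x y) := by
    intro x y h
    induction h with
    | refl => exact ⟨Quiver.Path.nil⟩
    | tail _ hbc ih => exact ih.map fun p => p.cons ⟨hbc⟩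
  intro x y
  obtain ⟨p⟩ := hpath x y ((hto _ x rfl).trans (hfrom y))
  -- Irreducibility asks for paths of positive length; the loop at `y` ensures this when `p` is
  -- empty.
  exact ⟨p.cons ⟨hdiag y⟩, by simp⟩

/-! ### Pairs of elements inside a multiset. -/

section Pairs

variable {ι : Type*} [Fintype ι] [DecidableEq ι]

omit [Fintype ι] in
theorem single_add_single_le {h : ι → ℕ} {p q : ι} (hp : h p ≠ 0) (hq : h q ≠ 0) (hpq : p ≠ q) :
    Pi.single p 1 + Pi.single q 1 ≤ h := by
  intro i
  by_cases h1 : i = p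
  · subst h1
    simp [hpq]
    omega
  · by_cases h2 : i = q
    · subst h2
      simp [h1]
      omega
    · simp [h1, h2]

theorem sum_mul_single_add_single (f : ι → ℕ) (p q : ι) :
    ∑ c, f c * (Pi.single p 1 + Pi.single q 1 : ι → ℕ) c = f p + f q := by
  simp [mul_add, Finset.sum_add_distrib, Pi.single_apply]

theorem add_le_sum_mul {f h : ι → ℕ} {p q : ι} (hle : Pi.single p 1 + Pi.single q 1 ≤ h) :
    f p + f q ≤ ∑ c, f c * h c := by
  rw [← sum_mul_single_add_single f]
  exact Finset.sum_le_sum fun c _ => Nat.mul_le_mul_left _ (hle c)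

/-- If no second element had positive value, one copy of `p` would carry the whole sum. The case `q
= p` is allowed and means multiplicity at least two. -/
theorem exists_single_add_single_le {f h : ι → ℕ} {p : ι} (hp : h p ≠ 0)
    (hlt : f p < ∑ c, f c * h c) : ∃ q, Pi.single p 1 + Pi.single q 1 ≤ h ∧ 0 < f q := by
  by_contra! hcon
  refine absurd hlt (not_lt.mpr ?_)
  have key : ∀ c, f c * h c ≤ f c * (Pi.single p 1 : ι → ℕ) c := by
    intro c
    rcases Nat.eq_zero_or_pos (f c) with h0 | h0
    · simp [h0]
    · refine Nat.mul_le_mul_left _ ?_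
      by_contra! hlt
      have h2 := hcon c
      by_cases hc : p = c
      · subst hc
        simp only [Pi.single_eq_same] at hlt
        refine absurd (h2 fun i => ?_) (by omega)
        by_cases hi : i = p
        · subst hi
          simp
          omega
        · simp [hi]
      · refine absurd (h2 (single_add_single_le hp ?_ hc)) (by omega)
        omega
  calc ∑ c, f c * h c ≤ ∑ c, f c * (Pi.single p 1 : ι → ℕ) c := Finset.sum_le_sum fun c _ => key c
    _ = f p := by simp [Pi.single_apply]

end Pairs

/-! ### Descending exchanges within one block `(M | 0 | S | T)`. -/

section Columns

variable {ℓ : ℕ}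

/-- The column `ℓ (e_i + e_j)` of `half`. -/
abbrev colM (e : Sym2 (Fin ℓ)) : HalfCol ℓ := Sum.inl e

/-- The zero column of `half`. -/
abbrev colZero : HalfCol ℓ := Sum.inr (Sum.inl ())

/-- The columns of the block `S` of `half`. -/
abbrev colS (i : Fin (ℓ - 2)) : HalfCol ℓ := Sum.inr (Sum.inr (Sum.inl i))

/-- The columns of the block `T` of `half`. -/
abbrev colT (i : Fin (2 * ℓ - 1)) : HalfCol ℓ := Sum.inr (Sum.inr (Sum.inr i))

theorem half_colM (r i j : Fin ℓ) :
    half ℓ r (colM s(i, j)) = ℓ * ((if r = i then 1 else 0) + (if r = j then 1 else 0)) := by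
  simp [half, matM, Pi.single_apply]

theorem half_colZero (r : Fin ℓ) : half ℓ r colZero = 0 := by
  simp [half]

theorem half_colS (r : Fin ℓ) (i : Fin (ℓ - 2)) :
    half ℓ r (colS i) = if r.val < i.val + 2 then 2 * ℓ else 0 := by
  simp [half, matS]

theorem half_colT (r : Fin ℓ) (i : Fin (2 * ℓ - 1)) : half ℓ r (colT i) = i.val + 2 := by
  simp [half, matT]

theorem sum_half_colM (e : Sym2 (Fin ℓ)) : ∑ r, half ℓ r (colM e) = 2 * ℓ := by
  induction e using Sym2.ind with
  | _ i j =>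
    simp only [half_colM, ← Finset.mul_sum, Finset.sum_add_distrib]
    simp [mul_comm]

theorem sum_half_colS (i : Fin (ℓ - 2)) : ∑ r, half ℓ r (colS i) = 2 * ℓ * (i.val + 2) := by
  simp only [half_colS]
  rw [← Finset.sum_filter, Finset.sum_const, smul_eq_mul, mul_comm]
  congr 1
  rw [Fin.card_filter_val_lt]
  omega

theorem sum_half_colT (i : Fin (2 * ℓ - 1)) : ∑ r, half ℓ r (colT i) = ℓ * (i.val + 2) := by
  simp [half_colT]

theorem two_mul_le_sum_half {c : HalfCol ℓ} (hc : c ≠ colZero) : 2 * ℓ ≤ ∑ r, half ℓ r c := by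
  rcases c with e | _ | i | i
  · rw [sum_half_colM]
  · exact absurd rfl hc
  · rw [sum_half_colS]; nlinarith
  · rw [sum_half_colT]; nlinarith

/-- The entries of the columns of `half`, and of the all-ones column `none`. -/
def halfEntry (r : Fin ℓ) : Option (HalfCol ℓ) → ℕ
  | none => 1
  | some c => half ℓ r c

/-- A potential that can be decreased by exchanging two columns. -/
def weight : Option (HalfCol ℓ) → ℕ
  | none => 0
  | some (Sum.inl e) => if e.IsDiag then 2 else 3
  | some (Sum.inr (Sum.inl _)) => 1
  | some (Sum.inr (Sum.inr (Sum.inl _))) => 2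
  | some (Sum.inr (Sum.inr (Sum.inr _))) => 1

/-- There is an exchange of two elements of `h` that decreases the potential. -/
def CanDescend (h : HalfCol ℓ → ℕ) : Prop :=
  ∃ (p q : HalfCol ℓ) (p' q' : Option (HalfCol ℓ)), Pi.single p 1 + Pi.single q 1 ≤ h ∧
    (∀ r, half ℓ r p + half ℓ r q = halfEntry r p' + halfEntry r q') ∧
    weight p' + weight q' < weight (some p) + weight (some q)

variable {h : HalfCol ℓ → ℕ} {a : ℕ}

theorem sum_sum_half_mul (hrow : ∀ r, ∑ c, half ℓ r c * h c = a) :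
    ∑ c, (∑ r, half ℓ r c) * h c = ℓ * a := by
  simp only [Finset.sum_mul]
  rw [Finset.sum_comm]
  simp [hrow]

/-- The entries total `ℓ * a`, while `a` nonzero columns would total at least `2 * ℓ * a`. -/
theorem colZero_mem (hℓ : 0 < ℓ) (ha : ∑ c, h c = a) (hrow : ∀ r, ∑ c, half ℓ r c * h c = a)
    (hpos : 0 < a) : h colZero ≠ 0 := by
  intro h0
  have h1 : ∑ c, 2 * ℓ * h c ≤ ∑ c, (∑ r, half ℓ r c) * h c := by
    refine Finset.sum_le_sum fun c _ => ?_
    by_cases hc : c = colZero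
    · simp [hc, h0]
    · exact Nat.mul_le_mul_right _ (two_mul_le_sum_half hc)
  rw [sum_sum_half_mul hrow, ← Finset.mul_sum, ha] at h1
  have : 0 < ℓ * a := by positivity
  nlinarith

/-- The zero column plus the constant `i + 2` equals an all-ones column plus the constant `i + 1`,
which for `i = 0` is a second all-ones column. -/
theorem canDescend_of_colT (h0 : h colZero ≠ 0) {i : Fin (2 * ℓ - 1)} (hi : h (colT i) ≠ 0) :
    CanDescend h := by
  refine ⟨colZero, colT i, none,
    if hz : i.val = 0 then none else some (colT ⟨i.val - 1, by omega⟩),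
    single_add_single_le h0 hi (by simp), fun r => ?_, ?_⟩
  · split_ifs with hz
    · simp [halfEntry, half_colZero, half_colT, hz]
    · simp [halfEntry, half_colZero, half_colT]
      omega
  · split_ifs <;> simp [weight]

/-- Without `T` all entries are multiples of `ℓ`, so `ℓ ∣ a`; all column sums are multiples of `2ℓ`,
so `2ℓ ∣ ℓ * a` and `a` is even. For odd `ℓ` these combine to `2ℓ ∣ a`. -/
theorem eq_two_mul_of_forall_colT (hodd : Odd ℓ) (hrow : ∀ r, ∑ c, half ℓ r c * h c = a)
    (hpos : 0 < a) (hle : a ≤ 2 * ℓ) (hT : ∀ i, h (colT i) = 0) : a = 2 * ℓ := by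
  have hℓ : 0 < ℓ := hodd.pos
  have h1 : ℓ ∣ a := by
    rw [← hrow ⟨0, hℓ⟩]
    refine Finset.dvd_sum fun c _ => ?_
    rcases c with e | _ | i | i
    · induction e using Sym2.ind with
      | _ i j => exact Dvd.dvd.mul_right (by rw [half_colM]; exact dvd_mul_right _ _) _
    · exact Dvd.dvd.mul_right (by simp [half]) _
    · refine Dvd.dvd.mul_right ?_ _
      rw [half_colS]
      split_ifs
      · exact dvd_mul_left _ _
      · exact dvd_zero _
    · simp [hT]
  have h2 : 2 * ℓ ∣ ℓ * a := by
    rw [← sum_sum_half_mul hrow]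
    refine Finset.dvd_sum fun c _ => ?_
    rcases c with e | _ | i | i
    · rw [sum_half_colM]; exact dvd_mul_right _ _
    · exact Dvd.dvd.mul_right (by simp [half]) _
    · rw [sum_half_colS, mul_assoc]; exact dvd_mul_right _ _
    · simp [hT]
  have h3 : 2 ∣ a := by
    rw [mul_comm 2 ℓ] at h2
    exact Nat.dvd_of_mul_dvd_mul_left hℓ h2
  have h4 : 2 * ℓ ∣ a := Nat.Coprime.mul_dvd_of_dvd_of_dvd
    (Nat.coprime_two_left.mpr hodd) h3 h1
  exact le_antisymm hle (Nat.le_of_dvd hpos h4)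

/-- The edge `{r, u}` supplies only `ℓ` of the `2ℓ` in row `r`. A column of `S` or a loop at `r`
would overshoot, so a second edge `{r, v}` is present, and the two are exchanged for `{r, r}` and
`{u, v}`. -/
theorem canDescend_of_not_isDiag (hrow : ∀ r, ∑ c, half ℓ r c * h c = 2 * ℓ)
    (hT : ∀ i, h (colT i) = 0) {e : Sym2 (Fin ℓ)} (he : ¬ e.IsDiag) (hmem : h (colM e) ≠ 0) :
    CanDescend h := by
  induction e using Sym2.ind with
  | _ r u =>
    have hℓ : 0 < ℓ := r.pos
    have hru : r ≠ u := by simpa using he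
    have hr : half ℓ r (colM s(r, u)) = ℓ := by simp [half_colM, hru]
    obtain ⟨q, hq, hq0⟩ := exists_single_add_single_le (f := half ℓ r) hmem (by
      rw [hrow, hr]; omega)
    have hq1 := add_le_sum_mul (f := half ℓ r) hq
    rw [hrow, hr] at hq1
    rcases q with e' | _ | i | i
    · obtain ⟨v, rfl⟩ : ∃ v, e' = s(r, v) := by
        induction e' using Sym2.ind with
        | _ v v' =>
          rw [half_colM] at hq0
          by_cases h1 : r = v
          · exact ⟨v', by rw [h1]⟩
          · by_cases h2 : r = v'
            · exact ⟨v, by rw [h2, Sym2.eq_swap]⟩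
            · simp [h1, h2] at hq0
      have hrv : r ≠ v := by
        rintro rfl
        simp only [half_colM, if_true] at hq1
        omega
      refine ⟨_, _, some (colM s(r, r)), some (colM s(u, v)), hq, fun t => ?_, ?_⟩
      · simp only [halfEntry, half_colM]
        ring
      · have : ¬ s(r, u).IsDiag := he
        have : ¬ s(r, v).IsDiag := by simpa using hrv
        simp only [weight]
        split_ifs <;> simp_all
    · rw [half_colZero] at hq0
      omega
    · rw [half_colS] at hq0 hq1
      split_ifs at hq0 hq1 <;> omega
    · have := hq (colT i)
      simp [hT] at this

theorem exists_loop_mem (hrow : ∀ r, ∑ c, half ℓ r c * h c = 2 * ℓ) (hT : ∀ i, h (colT i) = 0)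
    (hdiag : ∀ e, h (colM e) ≠ 0 → e.IsDiag) (r : Fin ℓ)
    (hS : ∀ i, h (colS i) ≠ 0 → i.val + 2 ≤ r.val) : h (colM s(r, r)) ≠ 0 := by
  have hℓ : 0 < ℓ := r.pos
  obtain ⟨c, -, hc⟩ := Finset.exists_ne_zero_of_sum_ne_zero
    (s := Finset.univ) (f := fun c => half ℓ r c * h c) (by rw [hrow]; omega)
  obtain ⟨h1, h2⟩ := mul_ne_zero_iff.mp hc
  rcases c with e | _ | i | i
  · have he := hdiag e h2
    induction e using Sym2.ind with
    | _ u v =>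
      obtain rfl : u = v := by simpa using he
      rw [half_colM] at h1
      by_cases hru : r = u
      · rwa [hru]
      · simp [hru] at h1
  · exact absurd (half_colZero r) h1
  · have := hS i h2
    rw [half_colS, if_neg (by omega)] at h1
    exact absurd rfl h1
  · exact absurd (hT i) h2

/-- Row `0` admits only one column of `S`, say number `i`. Row `i + 2`, the first it misses, is
filled by a loop; absorbing that loop gives the next column of `S`, or after the last one the
constant `2ℓ` in `T`, and frees a zero column. -/
theorem canDescend_of_colS (hrow : ∀ r, ∑ c, half ℓ r c * h c = 2 * ℓ)
    (hT : ∀ i, h (colT i) = 0) (hdiag : ∀ e, h (colM e) ≠ 0 → e.IsDiag) {i : Fin (ℓ - 2)}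
    (hi : h (colS i) ≠ 0) : CanDescend h := by
  have hlt : i.val + 2 < ℓ := by omega
  have hS : ∀ j, h (colS j) ≠ 0 → j = i := by
    intro j hj
    by_contra hne
    have := add_le_sum_mul (f := half ℓ ⟨0, by omega⟩)
      (single_add_single_le hj hi (by simpa using hne))
    rw [hrow, half_colS, half_colS, if_pos (by simp), if_pos (by simp)] at this
    omega
  have hloop := exists_loop_mem hrow hT hdiag ⟨i.val + 2, hlt⟩ fun j hj => by rw [hS j hj]
  refine ⟨_, _, if hj : i.val + 1 < ℓ - 2 then some (colS ⟨i.val + 1, hj⟩)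
    else some (colT ⟨2 * ℓ - 2, by omega⟩), some colZero,
    single_add_single_le hi hloop (by simp), fun r => ?_, ?_⟩
  · split_ifs with hj
    · simp only [halfEntry, half_colS, half_colM, half_colZero, Fin.ext_iff]
      split_ifs <;> omega
    · simp only [halfEntry, half_colS, half_colM, half_colT, half_colZero, Fin.ext_iff]
      have := r.isLt
      split_ifs <;> omega
  · split_ifs <;> simp [weight]

theorem canDescend_of_loops (hℓ : 3 ≤ ℓ) (hrow : ∀ r, ∑ c, half ℓ r c * h c = 2 * ℓ)
    (hT : ∀ i, h (colT i) = 0) (hdiag : ∀ e, h (colM e) ≠ 0 → e.IsDiag)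
    (hS : ∀ i, h (colS i) = 0) : CanDescend h := by
  have h0 := exists_loop_mem hrow hT hdiag ⟨0, by omega⟩ fun i hi => absurd (hS i) hi
  have h1 := exists_loop_mem hrow hT hdiag ⟨1, by omega⟩ fun i hi => absurd (hS i) hi
  refine ⟨_, _, some (colS ⟨0, by omega⟩), some colZero,
    single_add_single_le h0 h1 (by simp), fun r => ?_, ?_⟩
  · simp only [halfEntry, half_colS, half_colM, half_colZero, Fin.ext_iff]
    split_ifs <;> omega
  · simp [weight]

theorem canDescend (hℓ : 3 ≤ ℓ) (hodd : Odd ℓ) (ha : ∑ c, h c = a)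
    (hrow : ∀ r, ∑ c, half ℓ r c * h c = a) (hpos : 0 < a) (hle : a ≤ 2 * ℓ) : CanDescend h := by
  by_cases hT : ∀ i, h (colT i) = 0
  · obtain rfl := eq_two_mul_of_forall_colT hodd hrow hpos hle hT
    by_cases hdiag : ∀ e, h (colM e) ≠ 0 → e.IsDiag
    · by_cases hS : ∀ i, h (colS i) = 0
      · exact canDescend_of_loops hℓ hrow hT hdiag hS
      · push Not at hS
        obtain ⟨i, hi⟩ := hS
        exact canDescend_of_colS hrow hT hdiag hi
    · push Not at hdiag
      obtain ⟨e, he, hd⟩ := hdiag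
      exact canDescend_of_not_isDiag hrow hT hd he
  · push Not at hT
    obtain ⟨i, hi⟩ := hT
    exact canDescend_of_colT (colZero_mem (by omega) ha hrow hpos) hi

end Columns

/-! ### The two-block instance: left-right symmetry and irreducibility. -/

section Instances

variable {ℓ : ℕ}

/-- The column of `exV` that consists of ones. -/
abbrev colMid : ExCol ℓ := Sum.inr (Sum.inl ())

/-- The columns of the left block of `exV`. -/
abbrev colLeft (c : HalfCol ℓ) : ExCol ℓ := Sum.inl c

/-- The columns of the right block of `exV`. -/
abbrev colRight (c : HalfCol ℓ) : ExCol ℓ := Sum.inr (Sum.inr c)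

/-- The symmetry of the columns of `exV` that exchanges the left and the right block. -/
def flipCol : ExCol ℓ → ExCol ℓ
  | Sum.inl c => colRight c
  | Sum.inr (Sum.inl _) => colMid
  | Sum.inr (Sum.inr c) => colLeft c

theorem flipCol_flipCol (c : ExCol ℓ) : flipCol (flipCol c) = c := by
  rcases c with c | _ | c <;> rfl

/-- `flipCol` as a permutation. -/
def flipEquiv : ExCol ℓ ≃ ExCol ℓ := ⟨flipCol, flipCol, flipCol_flipCol, flipCol_flipCol⟩

theorem exV_flipCol (r : Fin ℓ ⊕ Fin ℓ) (c : ExCol ℓ) : exV ℓ r (flipCol c) = exV ℓ r.swap c := by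
  rcases r with r | r <;> rcases c with c | _ | c <;> rfl

theorem sum_comp_flipCol (f : ExCol ℓ → ℕ) : ∑ c, f (flipCol c) = ∑ c, f c :=
  Equiv.sum_comp flipEquiv f

theorem exV_mulVec_comp_flipCol (x : ExCol ℓ → ℕ) (r : Fin ℓ ⊕ Fin ℓ) :
    (exV ℓ *ᵥ (x ∘ flipCol)) r = (exV ℓ *ᵥ x) r.swap := by
  simp only [Matrix.mulVec, dotProduct, Function.comp_apply]
  rw [← sum_comp_flipCol fun c => exV ℓ r.swap c * x c]
  refine Finset.sum_congr rfl fun c _ => ?_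
  rw [exV_flipCol, Sum.swap_swap]

/-- The solutions of the instance. -/
abbrev exSolutions (ℓ : ℕ) : Finset (ExCol ℓ → ℕ) := solutions (exV ℓ) (exC ℓ) (2 * ℓ)

theorem sum_exCol (f : ExCol ℓ → ℕ) :
    ∑ c, f c = ∑ c, f (colLeft c) + (f colMid + ∑ c, f (colRight c)) := by
  simp [Fintype.sum_sum_type]

theorem exV_mulVec_inl (x : ExCol ℓ → ℕ) (r : Fin ℓ) :
    (exV ℓ *ᵥ x) (Sum.inl r) = ∑ c, half ℓ r c * x (colLeft c) +
      (x colMid + ∑ c, x (colRight c)) := by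
  simp only [Matrix.mulVec, dotProduct]
  rw [sum_exCol]
  simp [exV, ones]

theorem comp_flipCol_mem {x : ExCol ℓ → ℕ} (hx : x ∈ exSolutions ℓ) :
    x ∘ flipCol ∈ exSolutions ℓ := by
  rw [mem_solutions] at hx ⊢
  refine ⟨(sum_comp_flipCol x).trans hx.1, funext fun r => ?_⟩
  rw [exV_mulVec_comp_flipCol, hx.2]
  rfl

/-- Middle and right columns contribute their number to a top row, and both the row target and the
cardinality are `2ℓ`. -/
theorem sum_half_mul_colLeft {x : ExCol ℓ → ℕ} (hx : x ∈ exSolutions ℓ) (r : Fin ℓ) :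
    ∑ c, half ℓ r c * x (colLeft c) = ∑ c, x (colLeft c) := by
  obtain ⟨h1, h2⟩ := mem_solutions.mp hx
  have h3 := congrFun h2 (Sum.inl r)
  rw [exV_mulVec_inl, exC] at h3
  rw [sum_exCol] at h1
  omega

theorem mem_exSolutions_iff {x : ExCol ℓ → ℕ} (hR : ∀ c, x (colRight c) = 0) :
    x ∈ exSolutions ℓ ↔ ∑ c, x (colLeft c) + x colMid = 2 * ℓ ∧
      ∀ r, ∑ c, half ℓ r c * x (colLeft c) + x colMid = 2 * ℓ := by
  have h2 : ∀ r, (exV ℓ *ᵥ x) (Sum.inr r) = ∑ c, x (colLeft c) + x colMid := by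
    intro r
    rw [← Sum.swap_inl, ← exV_mulVec_comp_flipCol, exV_mulVec_inl]
    simp [flipCol, hR]
    rw [add_comm]
  rw [mem_solutions, sum_exCol]
  simp only [funext_iff, Sum.forall, exV_mulVec_inl, h2, hR, Finset.sum_const_zero, add_zero, exC]
  tauto

/-- The potential of a column of `exV`. -/
def exWeight : ExCol ℓ → ℕ
  | Sum.inl c => weight (some c)
  | Sum.inr (Sum.inl _) => 0
  | Sum.inr (Sum.inr c) => weight (some c)

theorem exWeight_flipCol (c : ExCol ℓ) : exWeight (flipCol c) = exWeight c := by
  rcases c with c | _ | c <;> rfl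

/-- An exchange of two elements of `x` that decreases the potential. -/
def ExCanDescend (x : ExCol ℓ → ℕ) : Prop :=
  ∃ z z' : ExCol ℓ → ℕ, z ≤ x ∧ ∑ c, z c = 2 ∧ ∑ c, z' c = 2 ∧ exV ℓ *ᵥ z = exV ℓ *ᵥ z' ∧
    ∑ c, exWeight c * z' c < ∑ c, exWeight c * z c

theorem ExCanDescend.of_comp_flipCol {x : ExCol ℓ → ℕ} (h : ExCanDescend (x ∘ flipCol)) :
    ExCanDescend x := by
  obtain ⟨z, z', h1, h2, h3, h4, h5⟩ := h
  have hw : ∀ z : ExCol ℓ → ℕ, ∑ c, exWeight c * (z ∘ flipCol) c = ∑ c, exWeight c * z c := by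
    intro z
    rw [← sum_comp_flipCol]
    refine Finset.sum_congr rfl fun c _ => ?_
    rw [exWeight_flipCol, Function.comp_apply, flipCol_flipCol]
  refine ⟨z ∘ flipCol, z' ∘ flipCol, fun c => ?_, ?_, ?_, ?_, ?_⟩
  · have := h1 (flipCol c)
    rwa [Function.comp_apply, flipCol_flipCol] at this
  · exact (sum_comp_flipCol z).trans h2
  · exact (sum_comp_flipCol z').trans h3
  · ext r
    rw [exV_mulVec_comp_flipCol, exV_mulVec_comp_flipCol, h4]
  · rwa [hw, hw]

/-- The columns of the left block and the middle column. -/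
def leftOrMid : Option (HalfCol ℓ) → ExCol ℓ
  | none => colMid
  | some c => colLeft c

theorem exV_leftOrMid_inl (r : Fin ℓ) (c : Option (HalfCol ℓ)) :
    exV ℓ (Sum.inl r) (leftOrMid c) = halfEntry r c := by
  cases c <;> rfl

theorem exV_leftOrMid_inr (r : Fin ℓ) (c : Option (HalfCol ℓ)) :
    exV ℓ (Sum.inr r) (leftOrMid c) = 1 := by
  cases c <;> rfl

theorem exWeight_leftOrMid (c : Option (HalfCol ℓ)) : exWeight (leftOrMid c) = weight c := by
  cases c <;> rfl

theorem sum_single_add_single {ι : Type*} [Fintype ι] [DecidableEq ι] (p q : ι) :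
    ∑ c, (Pi.single p 1 + Pi.single q 1 : ι → ℕ) c = 2 := by
  simpa using sum_mul_single_add_single (fun _ => 1) p q

/-- The bottom rows cannot obstruct the exchange: left and middle columns are all ones there. -/
theorem exCanDescend_of_canDescend {x : ExCol ℓ → ℕ} (h : CanDescend fun c => x (colLeft c)) :
    ExCanDescend x := by
  obtain ⟨p, q, p', q', h1, h2, h3⟩ := h
  refine ⟨Pi.single (leftOrMid (some p)) 1 + Pi.single (leftOrMid (some q)) 1,
    Pi.single (leftOrMid p') 1 + Pi.single (leftOrMid q') 1, fun c => ?_,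
    sum_single_add_single _ _, sum_single_add_single _ _, funext fun r => ?_, ?_⟩
  · rcases c with c | _ | c
    · have := h1 c
      simpa [leftOrMid, Pi.single_apply] using this
    · simp [leftOrMid]
    · simp [leftOrMid]
  · simp only [Matrix.mulVec, dotProduct]
    rw [sum_mul_single_add_single, sum_mul_single_add_single]
    rcases r with r | r
    · simp only [exV_leftOrMid_inl]
      exact h2 r
    · simp only [exV_leftOrMid_inr]
  · rw [sum_mul_single_add_single, sum_mul_single_add_single]
    simp only [exWeight_leftOrMid]
    exact h3

theorem exCanDescend_of_left (hℓ : 3 ≤ ℓ) (hodd : Odd ℓ) {x : ExCol ℓ → ℕ}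
    (hx : x ∈ exSolutions ℓ) (hpos : 0 < ∑ c, x (colLeft c)) : ExCanDescend x := by
  refine exCanDescend_of_canDescend (canDescend hℓ hodd rfl (sum_half_mul_colLeft hx) hpos ?_)
  have := (mem_solutions.mp hx).1
  rw [sum_exCol] at this
  omega

/-- The solution that uses only the middle column. -/
def allMid (ℓ : ℕ) : ExCol ℓ → ℕ := Pi.single colMid (2 * ℓ)

theorem allMid_mem (ℓ : ℕ) : allMid ℓ ∈ exSolutions ℓ := by
  rw [mem_exSolutions_iff (by simp [allMid])]
  simp [allMid]

theorem exCanDescend (hℓ : 3 ≤ ℓ) (hodd : Odd ℓ) {x : ExCol ℓ → ℕ} (hx : x ∈ exSolutions ℓ)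
    (hne : x ≠ allMid ℓ) : ExCanDescend x := by
  by_cases hL : ∑ c, x (colLeft c) = 0
  · by_cases hR : ∑ c, x (colRight c) = 0
    · refine absurd (funext fun c => ?_) hne
      have h1 := (mem_solutions.mp hx).1
      rw [sum_exCol] at h1
      simp only [Finset.sum_eq_zero_iff, Finset.mem_univ, true_implies] at hL hR
      rcases c with c | ⟨⟩ | c
      · simp [allMid, hL]
      · simp_all [allMid]
      · simp [allMid, hR]
    · exact .of_comp_flipCol (exCanDescend_of_left hℓ hodd (comp_flipCol_mem hx)
        (Nat.pos_of_ne_zero hR))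
  · exact exCanDescend_of_left hℓ hodd hx (Nat.pos_of_ne_zero hL)

theorem exP_isIrreducible (hℓ : 3 ≤ ℓ) (hodd : Odd ℓ) : (exP ℓ).IsIrreducible := by
  have hm : 2 ≤ 2 * ℓ := by omega
  refine isIrreducible_of_descent (transition_nonneg _ _ _ _ hm)
    (fun x => lt_of_lt_of_le (by norm_num) (transition_diag_ge _ _ _ _ hm x))
    (fun x y => ?_) (fun x => ∑ c, exWeight c * x.1 c) ⟨allMid ℓ, allMid_mem ℓ⟩ fun x hx => ?_
  · have := (transition_isHermitian (exV ℓ) (exC ℓ) (2 * ℓ) 2).apply x y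
    rw [star_trivial] at this
    exact this.symm
  · obtain ⟨z, z', h1, h2, h3, h4, h5⟩ := exCanDescend hℓ hodd x.2 fun h => hx (Subtype.ext h)
    obtain ⟨y, hy⟩ := exists_add_of_le h1
    rw [add_comm] at hy
    have hmem : y + z ∈ exSolutions ℓ := hy ▸ x.2
    have hlt : ∑ c, exWeight c * (y + z') c < ∑ c, exWeight c * x.1 c := by
      rw [hy]
      simp only [Pi.add_apply, mul_add, Finset.sum_add_distrib]
      omega
    refine ⟨⟨y + z', add_mem_solutions hmem (h2.trans h3.symm) h4⟩, ?_, hlt⟩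
    have hne : z ≠ z' := by
      rintro rfl
      exact lt_irrefl _ h5
    rw [exP, transition_apply_ne]
    · simp only [hy]
      exact moveProb_pos hmem h2 h3 h4 hne
    · intro h
      rw [h] at hlt
      exact lt_irrefl _ hlt

/-! ### The bottleneck around the graphical solutions. -/

section Bottleneck

theorem exists_eq_single_add_single {ι : Type*} [Fintype ι] [DecidableEq ι] {z : ι → ℕ} {p : ι}
    (hz : ∑ i, z i = 2) (hp : z p ≠ 0) : ∃ q, z = Pi.single p 1 + Pi.single q 1 := by
  obtain ⟨q, hq, -⟩ := exists_single_add_single_le (f := fun _ => 1) hp (by simp [hz])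
  refine ⟨q, funext fun i => le_antisymm ?_ (hq i)⟩
  by_contra! hlt
  have := Finset.sum_lt_sum (fun j _ => hq j) ⟨i, Finset.mem_univ i, hlt⟩
  rw [sum_single_add_single, hz] at this
  exact lt_irrefl _ this

/-- The columns outside of the blocks `M`, `0` and `S` on the left. -/
def IsOuter : ExCol ℓ → Prop
  | Sum.inl (Sum.inr (Sum.inr (Sum.inr _))) => True
  | Sum.inl _ => False
  | Sum.inr _ => True

/-- The multisets that use only columns of the blocks `M`, `0` and `S` on the left. -/
def IsGraphical (x : ExCol ℓ → ℕ) : Prop := ∀ c, IsOuter c → x c = 0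

theorem IsGraphical.colRight_eq_zero {x : ExCol ℓ → ℕ} (hx : IsGraphical x) (c : HalfCol ℓ) :
    x (colRight c) = 0 := hx _ trivial

theorem IsGraphical.colMid_eq_zero {x : ExCol ℓ → ℕ} (hx : IsGraphical x) : x colMid = 0 :=
  hx _ trivial

/-- This is what makes exits rare: an outer column is a positive constant on the top rows, so the
removed pair must be nonzero in every top row. -/
theorem IsOuter.exists_entry_eq {c : ExCol ℓ} (hc : IsOuter c) :
    ∃ t, 0 < t ∧ ∀ r, exV ℓ (Sum.inl r) c = t := by
  rcases c with (e | _ | i | i) | _ | c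
  · exact hc.elim
  · exact hc.elim
  · exact hc.elim
  · exact ⟨i.val + 2, by omega, fun r => half_colT r i⟩
  · exact ⟨1, one_pos, fun r => rfl⟩
  · exact ⟨1, one_pos, fun r => rfl⟩

theorem eq_or_eq_of_half_colM_ne_zero {r i j : Fin ℓ} (h : half ℓ r (colM s(i, j)) ≠ 0) :
    r = i ∨ r = j := by
  by_contra! hcon
  simp [half_colM, hcon] at h

theorem card_half_colM_ne_zero_le (e : Sym2 (Fin ℓ)) :
    (Finset.univ.filter fun r => half ℓ r (colM e) ≠ 0).card ≤ 2 := by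
  induction e using Sym2.ind with
  | _ i j =>
    refine le_trans (Finset.card_le_card (t := {i, j}) fun r hr => ?_) Finset.card_le_two
    simpa using eq_or_eq_of_half_colM_ne_zero (Finset.mem_filter.mp hr).2

theorem exists_add_eq_zero (hℓ : 5 ≤ ℓ) {p q : HalfCol ℓ}
    (hp : (Finset.univ.filter fun r => half ℓ r p ≠ 0).card ≤ 2)
    (hq : (Finset.univ.filter fun r => half ℓ r q ≠ 0).card ≤ 2) :
    ∃ r, half ℓ r p + half ℓ r q = 0 := by
  by_contra! hcon
  have : (Finset.univ : Finset (Fin ℓ)).card ≤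
      ((Finset.univ.filter fun r => half ℓ r p ≠ 0) ∪
        (Finset.univ.filter fun r => half ℓ r q ≠ 0)).card := by
    refine Finset.card_le_card fun r _ => ?_
    have := hcon r
    simp only [Finset.mem_union, Finset.mem_filter, Finset.mem_univ, true_and]
    omega
  have h2 := Finset.card_union_le (Finset.univ.filter fun r => half ℓ r p ≠ 0)
    (Finset.univ.filter fun r => half ℓ r q ≠ 0)
  rw [Finset.card_univ, Fintype.card_fin] at this
  omega

theorem exV_inl_colLeft (r : Fin ℓ) (c : HalfCol ℓ) :
    exV ℓ (Sum.inl r) (colLeft c) = half ℓ r c := rfl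

/-- No column has the entry `u + ℓ` in rows `0`, `1`, `2` and the entry `u` in the last row. -/
theorem not_entry_eq_add (hℓ : 5 ≤ ℓ) (c : ExCol ℓ)
    (h : ∀ r : Fin ℓ, r.val < 3 →
      exV ℓ (Sum.inl r) c = exV ℓ (Sum.inl ⟨ℓ - 1, by omega⟩) c + ℓ) : False := by
  have h0 := h ⟨0, by omega⟩ (by simp)
  have h1 := h ⟨1, by omega⟩ (by simp)
  have h2 := h ⟨2, by omega⟩ (by simp)
  rcases c with c | _ | c
  · simp only [exV_inl_colLeft] at h0 h1 h2
    rcases c with e | _ | i | i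
    · induction e using Sym2.ind with
      | _ u v =>
        -- A column of `M` would have to be nonzero in three rows, but it is supported on two.
        have hne : ∀ a b : ℕ, a = b + ℓ → a ≠ 0 := by omega
        have h0' := eq_or_eq_of_half_colM_ne_zero (hne _ _ h0)
        have h1' := eq_or_eq_of_half_colM_ne_zero (hne _ _ h1)
        have h2' := eq_or_eq_of_half_colM_ne_zero (hne _ _ h2)
        simp only [Fin.ext_iff] at h0' h1' h2'
        omega
    · simp [half] at h0
      omega
    · rw [half_colS, half_colS, if_pos (by simp), if_neg (by simp only; omega)] at h0
      omega
    · simp only [half_colT] at h0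
      omega
  · change 1 = 1 + ℓ at h0
    omega
  · change 1 = 1 + ℓ at h0
    omega

/-- The edge `e` must cover all rows from `i + 2` on, hence the last row and at most one more. If it
covers two, the pair sums to `2ℓ` on rows `0`, `1`, `2` and to `ℓ` on the last row, which
`not_entry_eq_add` excludes. -/
theorem eq_last_of_exchange_colS_colM (hℓ : 5 ≤ ℓ) {i : Fin (ℓ - 2)} {e : Sym2 (Fin ℓ)}
    (hle : ∀ r, half ℓ r (colS i) + half ℓ r (colM e) ≤ 2 * ℓ) {t : ℕ} (ht : 0 < t) {c : ExCol ℓ}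
    (heq : ∀ r, half ℓ r (colS i) + half ℓ r (colM e) = t + exV ℓ (Sum.inl r) c) :
    i = ⟨ℓ - 3, by omega⟩ ∧ e = s(⟨ℓ - 1, by omega⟩, ⟨ℓ - 1, by omega⟩) := by
  have hcov : ∀ r : Fin ℓ, i.val + 2 ≤ r.val → half ℓ r (colM e) ≠ 0 := by
    intro r hr h0
    have := heq r
    rw [half_colS, if_neg (by omega), h0] at this
    omega
  obtain ⟨a, rfl⟩ : ∃ a, e = s(a, ⟨ℓ - 1, by omega⟩) := by
    have hlast := hcov ⟨ℓ - 1, by omega⟩ (by simp only; omega)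
    induction e using Sym2.ind with
    | _ a b =>
      rcases eq_or_eq_of_half_colM_ne_zero hlast with h | h
      · exact ⟨b, by rw [h, Sym2.eq_swap]⟩
      · exact ⟨a, by rw [h]⟩
  have hcov' : ∀ r : ℕ, i.val + 2 ≤ r → r < ℓ - 1 → r = a.val := by
    intro r h1 h2
    rcases eq_or_eq_of_half_colM_ne_zero (hcov ⟨r, by omega⟩ h1) with h | h
    · exact congrArg Fin.val h
    · rw [Fin.ext_iff] at h
      simp only at h
      omega
  by_cases ha : a.val = ℓ - 1
  · have hlast : a = ⟨ℓ - 1, by omega⟩ := Fin.ext ha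
    refine ⟨Fin.ext ?_, by rw [hlast]⟩
    by_contra hi
    change ¬ i.val = ℓ - 3 at hi
    have := hcov' (i.val + 2) le_rfl (by omega)
    omega
  · exfalso
    -- Otherwise row `a` would sum to `3ℓ`.
    have ha' : i.val + 2 ≤ a.val := by
      by_contra! hlt
      have := hle a
      rw [half_colS, if_pos hlt, half_colM, if_pos rfl, mul_add] at this
      omega
    have hi : i.val + 4 = ℓ := by
      have h1 := hcov' (i.val + 2) le_rfl (by omega)
      by_contra hne
      have h2 := hcov' (i.val + 3) (by omega) (by omega)
      omega
    refine not_entry_eq_add hℓ c fun r hr => ?_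
    have h1 := heq r
    have h2 := heq ⟨ℓ - 1, by omega⟩
    rw [half_colS, if_pos (by omega), half_colM, if_neg (by rw [Fin.ext_iff]; omega),
      if_neg (by rw [Fin.ext_iff]; simp only; omega)] at h1
    rw [half_colS, if_neg (by simp only; omega), half_colM,
      if_neg (by rw [Fin.ext_iff]; simp only; omega), if_pos rfl] at h2
    omega

/-- The only exchange of two columns of `M`, `0`, `S` on the left against a pair of columns of
which one is an outer column. -/
theorem eq_last_of_exchange (hℓ : 5 ≤ ℓ) {p q : HalfCol ℓ} (hp : ¬ IsOuter (colLeft p))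
    (hq : ¬ IsOuter (colLeft q)) (hle : ∀ r, half ℓ r p + half ℓ r q ≤ 2 * ℓ) {t : ℕ} (ht : 0 < t)
    {c : ExCol ℓ} (heq : ∀ r, half ℓ r p + half ℓ r q = t + exV ℓ (Sum.inl r) c) :
    (p = colS ⟨ℓ - 3, by omega⟩ ∧ q = colM s(⟨ℓ - 1, by omega⟩, ⟨ℓ - 1, by omega⟩)) ∨
      (q = colS ⟨ℓ - 3, by omega⟩ ∧ p = colM s(⟨ℓ - 1, by omega⟩, ⟨ℓ - 1, by omega⟩)) := by
  have hcov : ∀ r, half ℓ r p + half ℓ r q ≠ 0 := fun r => by rw [heq]; omega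
  have hS : ∀ i : Fin (ℓ - 2), half ℓ ⟨ℓ - 1, by omega⟩ (colS i) = 0 := fun i => by
    rw [half_colS, if_neg (by simp only; omega)]
  have hsmall : ∀ c : HalfCol ℓ, ¬ IsOuter (colLeft c) → (∃ i, c = colS i) ∨
      (Finset.univ.filter fun r => half ℓ r c ≠ 0).card ≤ 2 := by
    intro c hc
    rcases c with e | _ | i | i
    · exact Or.inr (card_half_colM_ne_zero_le e)
    · exact Or.inr (by simp [half])
    · exact Or.inl ⟨i, rfl⟩
    · exact (hc trivial).elim
  rcases p with e | _ | i | i <;> rcases q with e' | _ | i' | i'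
  all_goals first
    | exact (hp trivial).elim
    | exact (hq trivial).elim
    | skip
  case inr.inr.inl.inl =>
    obtain ⟨h1, h2⟩ := eq_last_of_exchange_colS_colM hℓ hle ht heq
    exact Or.inl ⟨by rw [h1], by rw [h2]⟩
  case inl.inr.inr.inl =>
    simp only [add_comm (half ℓ _ (colM e))] at hle heq
    obtain ⟨h1, h2⟩ := eq_last_of_exchange_colS_colM hℓ hle ht heq
    exact Or.inr ⟨by rw [h1], by rw [h2]⟩
  case inr.inr.inl.inr.inr.inl =>
    exact absurd (by rw [hS, hS]) (hcov ⟨ℓ - 1, by omega⟩)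
  case inr.inr.inl.inr.inl =>
    exact absurd (by rw [hS]; simp [half]) (hcov ⟨ℓ - 1, by omega⟩)
  case inr.inl.inr.inr.inl =>
    exact absurd (by rw [hS]; simp [half]) (hcov ⟨ℓ - 1, by omega⟩)
  -- Two columns with at most two nonzero rows each cannot cover `ℓ ≥ 5` rows.
  all_goals
    obtain ⟨r, hr⟩ := exists_add_eq_zero hℓ ((hsmall _ hp).resolve_left (by simp))
      ((hsmall _ hq).resolve_left (by simp))
    exact absurd hr (hcov r)

/-- The pair of columns by whose exchange the chain can leave the graphical solutions. -/
def exitPair (hℓ : 5 ≤ ℓ) : ExCol ℓ → ℕ :=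
  Pi.single (colLeft (colS ⟨ℓ - 3, by omega⟩)) 1 +
    Pi.single (colLeft (colM s(⟨ℓ - 1, by omega⟩, ⟨ℓ - 1, by omega⟩))) 1

/-- The solution from which the chain can leave the graphical solutions. -/
def exitSolution (hℓ : 5 ≤ ℓ) : ExCol ℓ → ℕ :=
  exitPair hℓ + Pi.single (colLeft colZero) (2 * ℓ - 2)

theorem sum_exV_mul {x : ExCol ℓ → ℕ} (hx : x ∈ exSolutions ℓ) (r : Fin ℓ ⊕ Fin ℓ) :
    ∑ c, exV ℓ r c * x c = 2 * ℓ := congrFun (mem_solutions.mp hx).2 r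

theorem not_isOuter_of_ne_zero {x : ExCol ℓ → ℕ} (hx : IsGraphical x) {c : ExCol ℓ}
    (hc : x c ≠ 0) : ¬ IsOuter c := fun h => hc (hx c h)

theorem exists_colLeft_of_not_isOuter {c : ExCol ℓ} (hc : ¬ IsOuter c) :
    ∃ c', c = colLeft c' := by
  rcases c with c | _ | c
  · exact ⟨c, rfl⟩
  · exact (hc trivial).elim
  · exact (hc trivial).elim

theorem eq_exitPair (hℓ : 5 ≤ ℓ) {x y : ExCol ℓ → ℕ} (hx : x ∈ exSolutions ℓ)
    (hgx : IsGraphical x) (hgy : ¬ IsGraphical y) {z : (ExCol ℓ → ℕ) × (ExCol ℓ → ℕ)}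
    (hz : z ∈ swaps (exV ℓ) 2 x y) : z.1 = exitPair hℓ := by
  obtain ⟨⟨h1, h2⟩, hV, hle, -, -⟩ := mem_swaps.mp hz
  have hadd := add_eq_of_mem_swaps hz
  rw [IsGraphical] at hgy
  push Not at hgy
  obtain ⟨c, hc, hyc⟩ := hgy
  have hzc : z.2 c ≠ 0 := by
    rw [← hadd] at hyc
    simp [hgx c hc] at hyc
    exact hyc
  obtain ⟨c', hc'⟩ := exists_eq_single_add_single h2 hzc
  obtain ⟨p, -, hp⟩ := Finset.exists_ne_zero_of_sum_ne_zero (s := Finset.univ) (f := z.1)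
    (by rw [h1]; exact two_ne_zero)
  obtain ⟨q, hq⟩ := exists_eq_single_add_single h1 hp
  have hp' := not_isOuter_of_ne_zero hgx (c := p) (by have := hle p; omega)
  have hq' := not_isOuter_of_ne_zero hgx (c := q) (by
    have := hle q
    rw [hq] at this
    simp at this
    omega)
  obtain ⟨p, rfl⟩ := exists_colLeft_of_not_isOuter hp'
  obtain ⟨q, rfl⟩ := exists_colLeft_of_not_isOuter hq'
  obtain ⟨t, ht, htc⟩ := hc.exists_entry_eq
  have hle2 : ∀ r, half ℓ r p + half ℓ r q ≤ 2 * ℓ := fun r => by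
    rw [← sum_exV_mul hx (Sum.inl r)]
    exact add_le_sum_mul (f := exV ℓ (Sum.inl r)) (p := colLeft p) (q := colLeft q) (hq ▸ hle)
  have heq : ∀ r, half ℓ r p + half ℓ r q = t + exV ℓ (Sum.inl r) c' := fun r => by
    have := congrFun hV (Sum.inl r)
    simp only [Matrix.mulVec, dotProduct] at this
    rw [hq, hc', sum_mul_single_add_single, sum_mul_single_add_single, htc] at this
    exact this
  rcases eq_last_of_exchange hℓ hp' hq' hle2 ht heq with ⟨hp1, hq1⟩ | ⟨hq1, hp1⟩
  · rw [hq, hp1, hq1, exitPair]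
  · rw [hq, hp1, hq1, exitPair, add_comm]

theorem half_add_half_exitPair (hℓ : 5 ≤ ℓ) (r : Fin ℓ) :
    half ℓ r (colS ⟨ℓ - 3, by omega⟩) +
      half ℓ r (colM s(⟨ℓ - 1, by omega⟩, ⟨ℓ - 1, by omega⟩)) = 2 * ℓ := by
  rw [half_colS, half_colM]
  simp only [Fin.ext_iff]
  split_ifs <;> omega

/-- The exit pair already fills every top row with `2ℓ`, so only zero columns can accompany it. -/
theorem eq_exitSolution (hℓ : 5 ≤ ℓ) {x : ExCol ℓ → ℕ} (hx : x ∈ exSolutions ℓ)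
    (hgx : IsGraphical x) (hle : exitPair hℓ ≤ x) : x = exitSolution hℓ := by
  obtain ⟨w, rfl⟩ := exists_add_of_le hle
  have hsum : ∑ c, w c = 2 * ℓ - 2 := by
    have := (mem_solutions.mp hx).1
    simp only [Pi.add_apply, Finset.sum_add_distrib] at this
    have h2 : ∑ c, exitPair hℓ c = 2 := sum_single_add_single _ _
    omega
  have hrow : ∀ r, ∑ c, exV ℓ (Sum.inl r) c * w c = 0 := by
    intro r
    have := sum_exV_mul hx (Sum.inl r)
    simp only [Pi.add_apply, mul_add, Finset.sum_add_distrib] at this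
    have h2 : ∑ c, exV ℓ (Sum.inl r) c * exitPair hℓ c = 2 * ℓ :=
      (sum_mul_single_add_single _ _ _).trans (half_add_half_exitPair hℓ r)
    omega
  have hw : ∀ c, c ≠ colLeft colZero → w c = 0 := by
    intro c hc
    by_contra hwc
    have hout := not_isOuter_of_ne_zero hgx (c := c) (by simp [hwc])
    obtain ⟨c, rfl⟩ := exists_colLeft_of_not_isOuter hout
    have h1 : ∀ r, half ℓ r c = 0 := by
      intro r
      have h2 := Finset.sum_eq_zero_iff.mp (hrow r) (colLeft c) (Finset.mem_univ _)
      exact (mul_eq_zero.mp h2).resolve_right hwc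
    have h3 := two_mul_le_sum_half (c := c) (by rintro rfl; exact hc rfl)
    simp only [h1, Finset.sum_const_zero] at h3
    omega
  have h0 : w (colLeft colZero) = 2 * ℓ - 2 := by
    rw [← hsum]
    exact (Finset.sum_eq_single _ (fun c _ hc => hw c hc) (by simp)).symm
  rw [exitSolution]
  congr 1
  ext c
  by_cases hc : c = colLeft colZero
  · rw [hc, h0, Pi.single_eq_same]
  · rw [hw c hc, Pi.single_eq_of_ne hc]

open Classical in
/-- The graphical solutions. -/
noncomputable def graphical (ℓ : ℕ) : Finset (exSolutions ℓ) :=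
  Finset.univ.filter fun x => IsGraphical x.1

theorem mem_graphical {x : exSolutions ℓ} : x ∈ graphical ℓ ↔ IsGraphical x.1 := by
  simp [graphical]

theorem flow_graphical_le (hℓ : 5 ≤ ℓ) :
    ∑ x ∈ graphical ℓ, ∑ y ∈ (graphical ℓ)ᶜ, exP ℓ x y ≤ 1 / (2 * ((2 * ℓ).choose 2 : ℝ)) := by
  refine (flow_le (exV ℓ) (exC ℓ) (2 * ℓ) 2 (graphical ℓ)
    (fun x => if x = exitSolution hℓ then {exitPair hℓ} else ∅) fun x hx y hy p hp => ?_).trans ?_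
  · rw [mem_graphical] at hx hy
    have h1 := eq_exitPair hℓ x.2 hx hy hp
    have h2 := eq_exitSolution hℓ x.2 hx (h1 ▸ (mem_swaps.mp hp).2.2.1)
    rw [if_pos h2, Finset.mem_singleton, h1]
  · refine mul_le_of_le_one_right (by positivity) ?_
    have h1 : ∀ x : exSolutions ℓ,
        ((if x.1 = exitSolution hℓ then {exitPair hℓ} else ∅ : Finset (ExCol ℓ → ℕ)).card : ℝ) =
          if x.1 = exitSolution hℓ then 1 else 0 := fun x => by split_ifs <;> simp
    simp only [h1]
    rw [← Finset.sum_filter, Finset.sum_const, nsmul_eq_mul, mul_one]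
    have : ((graphical ℓ).filter fun x => x.1 = exitSolution hℓ).card ≤ 1 :=
      Finset.card_le_one.mpr fun a ha b hb => Subtype.ext
        ((Finset.mem_filter.mp ha).2.trans (Finset.mem_filter.mp hb).2.symm)
    exact_mod_cast this

/-- Exchanging the blocks injects the graphical solutions into the others, since no nonempty
multiset lives on both sides of the exchange. -/
theorem card_graphical_le_card_compl (hℓ : 0 < ℓ) :
    (graphical ℓ).card ≤ (graphical ℓ)ᶜ.card := by
  refine Finset.card_le_card_of_injOn (fun x => ⟨x.1 ∘ flipCol, comp_flipCol_mem x.2⟩)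
    (fun x hx => ?_) fun x _ y _ h => ?_
  · rw [Finset.mem_coe, mem_graphical] at hx
    rw [Finset.mem_coe, Finset.mem_compl, mem_graphical]
    intro hflip
    have h1 := (mem_solutions.mp x.2).1
    have h2 : ∀ c, x.1 (colLeft c) = 0 := hflip.colRight_eq_zero
    rw [sum_exCol] at h1
    simp only [hx.colMid_eq_zero, hx.colRight_eq_zero, h2, Finset.sum_const_zero] at h1
    omega
  · refine Subtype.ext (funext fun c => ?_)
    have := congrFun (Subtype.ext_iff.mp h) (flipCol c)
    simpa [flipCol_flipCol] using this

end Bottleneck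

/-! ### Many graphical solutions from Hamiltonian cycles. -/

section Cycles

variable {n : ℕ}

/-- The solution given by the Hamiltonian cycle with vertices `ρ 0, ρ 1, …`. -/
def cycle (ρ : Equiv.Perm (Fin (n + 2))) : ExCol (n + 2) → ℕ :=
  ∑ i, Pi.single (colLeft (colM s(ρ i, ρ (i + 1)))) 1 + Pi.single (colLeft colZero) (n + 2)

theorem cycle_isGraphical (ρ : Equiv.Perm (Fin (n + 2))) : IsGraphical (cycle ρ) := by
  intro c hc
  rcases c with (e | _ | i | i) | _ | c
  · exact hc.elim
  · exact hc.elim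
  · exact hc.elim
  all_goals simp [cycle, Finset.sum_apply]

theorem sum_mul_cycle (f : HalfCol (n + 2) → ℕ) (ρ : Equiv.Perm (Fin (n + 2))) :
    ∑ c, f c * cycle ρ (colLeft c) =
      ∑ i, f (colM s(ρ i, ρ (i + 1))) + f colZero * (n + 2) := by
  simp only [cycle, Pi.add_apply, Finset.sum_apply, mul_add, Finset.sum_add_distrib,
    Finset.mul_sum]
  rw [Finset.sum_comm]
  have h1 : ∀ (c : HalfCol (n + 2)) (k : ℕ),
      ∑ c', f c' * (Pi.single (colLeft c) k : ExCol (n + 2) → ℕ) (colLeft c') = f c * k := by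
    intro c k
    rw [Finset.sum_eq_single c]
    · rw [Pi.single_eq_same]
    · intro c' _ hne
      rw [Pi.single_eq_of_ne (by simpa using hne), mul_zero]
    · simp
  simp only [h1, mul_one]
  ring

theorem cycle_mem (ρ : Equiv.Perm (Fin (n + 2))) : cycle ρ ∈ exSolutions (n + 2) := by
  rw [mem_exSolutions_iff (cycle_isGraphical ρ).colRight_eq_zero,
    (cycle_isGraphical ρ).colMid_eq_zero]
  refine ⟨?_, fun r => ?_⟩
  · have := sum_mul_cycle (fun _ => 1) ρ
    simp only [one_mul] at this
    rw [this]
    simp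
    ring
  · rw [sum_mul_cycle, half_colZero]
    simp only [half_colM, ← Finset.mul_sum, Finset.sum_add_distrib]
    have h1 : ∑ i, (if r = ρ i then 1 else 0) = 1 := by
      rw [Equiv.sum_comp ρ fun j => if r = j then 1 else 0]
      simp
    have h2 : ∑ i, (if r = ρ (i + 1) then 1 else 0) = 1 := by
      exact (Equiv.sum_comp (Equiv.addRight 1) fun i => if r = ρ i then 1 else 0).trans h1
    rw [h1, h2]
    ring

theorem cycle_colM_ne_zero (ρ : Equiv.Perm (Fin (n + 2))) (e : Sym2 (Fin (n + 2))) :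
    cycle ρ (colLeft (colM e)) ≠ 0 ↔ ∃ i, e = s(ρ i, ρ (i + 1)) := by
  simp [cycle, Finset.sum_apply, Pi.single_apply]

/-- Fixing the first two vertices fixes the starting point and the orientation; the edge set then
determines each next vertex. -/
theorem eq_of_cycle_eq {ρ ρ' : Equiv.Perm (Fin (n + 2))} (h0 : ρ 0 = ρ' 0) (h1 : ρ 1 = ρ' 1)
    (h : cycle ρ = cycle ρ') : ρ = ρ' := by
  have hedge : ∀ i, ∃ j, s(ρ i, ρ (i + 1)) = s(ρ' j, ρ' (j + 1)) := by
    intro i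
    rw [← cycle_colM_ne_zero, ← h, cycle_colM_ne_zero]
    exact ⟨i, rfl⟩
  have key : ∀ k : ℕ, ∀ hk : k + 1 < n + 2, ρ ⟨k, by omega⟩ = ρ' ⟨k, by omega⟩ ∧
      ρ ⟨k + 1, hk⟩ = ρ' ⟨k + 1, hk⟩ := by
    intro k
    induction k with
    | zero => exact fun _ => ⟨h0, h1⟩
    | succ k ih =>
      intro hk
      obtain ⟨ih0, ih1⟩ := ih (by omega)
      refine ⟨ih1, ?_⟩
      have hsucc : ∀ (l : ℕ) (hl : l + 1 < n + 2),
          (⟨l, by omega⟩ + 1 : Fin (n + 2)) = ⟨l + 1, hl⟩ := by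
        intro l hl
        ext
        simp [Fin.val_add, Nat.mod_eq_of_lt hl]
      obtain ⟨j, hj⟩ := hedge ⟨k + 1, by omega⟩
      rw [hsucc (k + 1) hk, Sym2.eq_iff] at hj
      rcases hj with ⟨hj1, hj2⟩ | ⟨hj1, hj2⟩
      · rw [ih1, ρ'.apply_eq_iff_eq] at hj1
        rw [hj2, ← hj1, hsucc (k + 1) hk]
      -- Here the edge would lead back to the vertex at position `k`, contradicting injectivity of
      -- `ρ`.
      · rw [ih1, ρ'.apply_eq_iff_eq, ← hsucc k (by omega), add_left_inj] at hj1
        rw [← hj1, ← ih0, ρ.apply_eq_iff_eq, Fin.ext_iff] at hj2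
        simp only at hj2
        omega
  ext i
  by_cases hi : i.val + 1 < n + 2
  · rw [(key i.val hi).1]
  · have : i = ⟨n + 1, by omega⟩ := by ext; simp only; omega
    rw [this, (key n (by omega)).2]

theorem factorial_le_card_graphical (n : ℕ) : n.factorial ≤ (graphical (n + 2)).card := by
  let ext : Equiv.Perm (Fin n) → Equiv.Perm (Fin (n + 2)) := fun σ =>
    Equiv.Perm.decomposeFin.symm (0, Equiv.Perm.decomposeFin.symm (0, σ))
  have hinj : Function.Injective ext := by
    intro σ τ h
    simpa [ext] using h
  have h0 : ∀ σ, ext σ 0 = 0 := fun σ => by simp [ext]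
  have h1 : ∀ σ, ext σ 1 = 1 := fun σ => by
    simp only [ext]
    rw [← Fin.succ_zero_eq_one, Equiv.Perm.decomposeFin_symm_apply_succ]
    simp
  calc n.factorial = (Finset.univ : Finset (Equiv.Perm (Fin n))).card := by
        rw [Finset.card_univ, Fintype.card_perm, Fintype.card_fin]
    _ ≤ (graphical (n + 2)).card := by
        refine Finset.card_le_card_of_injOn (fun σ => ⟨cycle (ext σ), cycle_mem _⟩)
          (fun σ _ => ?_) fun σ _ τ _ h => ?_
        · exact mem_graphical.mpr (cycle_isGraphical _)
        · exact hinj (eq_of_cycle_eq (by rw [h0, h0]) (by rw [h1, h1]) (Subtype.ext_iff.mp h))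

end Cycles

/-! ### The spectral gap and relaxation time bounds. -/

theorem one_sub_secondEigenvalue_exP_le (hℓ : 5 ≤ ℓ) :
    1 - secondEigenvalue (exP ℓ) ≤ 1 / (ℓ.factorial : ℝ) := by
  obtain ⟨n, rfl⟩ : ∃ n, ℓ = n + 2 := ⟨ℓ - 2, by omega⟩
  have hU := factorial_le_card_graphical n
  have hUc := card_graphical_le_card_compl (ℓ := n + 2) (by omega)
  have hfac := n.factorial_pos
  have hflow := flow_graphical_le hℓ
  have hcut := one_sub_secondEigenvalue_mul_le
    (transition_isHermitian (exV (n + 2)) (exC (n + 2)) (2 * (n + 2)) 2)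
    (transition_row_sum (exV (n + 2)) (exC (n + 2)) (2 * (n + 2)) 2 _) (graphical (n + 2))
    (Finset.card_pos.mp (by omega)) (Finset.card_pos.mp (by omega))
    (Finset.sum_nonneg fun x _ => Finset.sum_nonneg fun y _ =>
      transition_nonneg _ _ _ _ (by omega) _ _)
  change (1 - secondEigenvalue (exP (n + 2))) * _ ≤
    (∑ x ∈ graphical (n + 2), ∑ y ∈ (graphical (n + 2))ᶜ, exP (n + 2) x y) * _ at hcut
  generalize secondEigenvalue (exP (n + 2)) = s at hcut ⊢
  generalize ∑ x ∈ graphical (n + 2), ∑ y ∈ (graphical (n + 2))ᶜ, exP (n + 2) x y = Q at hcut hflow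
  generalize (graphical (n + 2)).card = u at *
  generalize (graphical (n + 2))ᶜ.card = u' at *
  have hchoose : ((2 * (n + 2)).choose 2 : ℝ) = (n + 2) * (2 * n + 3) := by
    rw [Nat.cast_choose_two]
    push_cast
    ring
  have hfact : ((n + 2).factorial : ℝ) = (n + 2) * (n + 1) * n.factorial := by
    rw [Nat.factorial_succ, Nat.factorial_succ]
    push_cast
    ring
  rw [hchoose] at hflow
  rw [hfact]
  have hn : (0 : ℝ) ≤ n := n.cast_nonneg
  have hF : (0 : ℝ) < n.factorial := by exact_mod_cast hfac
  have hu : (n.factorial : ℝ) ≤ u := by exact_mod_cast hU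
  have hu' : (u : ℝ) ≤ u' := by exact_mod_cast hUc
  have hu0 : (0 : ℝ) < u := hF.trans_le hu
  have hu0' : (0 : ℝ) < u' := hu0.trans_le hu'
  by_cases hs : 1 - s ≤ 0
  · exact hs.trans (by positivity)
  push Not at hs
  have h1 : (1 - s) * u ≤ 1 / ((n + 2) * (2 * n + 3)) := by
    refine le_of_mul_le_mul_right ?_ hu0'
    calc (1 - s) * u * u' = (1 - s) * (u * u') := by ring
      _ ≤ Q * (u + u') := hcut
      _ ≤ 1 / (2 * ((n + 2) * (2 * n + 3))) * (u + u') := by gcongr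
      _ ≤ 1 / (2 * ((n + 2) * (2 * n + 3))) * (u' + u') := by gcongr
      _ = 1 / ((n + 2) * (2 * n + 3)) * u' := by field_simp; ring
  rw [le_div_iff₀ (by positivity)] at h1 ⊢
  refine le_trans ?_ h1
  -- With `ℓ = n + 2`, the factor `(2ℓ).choose 2 = ℓ * (2ℓ - 1)` is at least `ℓ * (ℓ - 1)` and lifts
  -- `(ℓ-2)!` to `ℓ!`.
  have h2 : ((n : ℝ) + 2) * (n + 1) * n.factorial ≤ u * ((n + 2) * (2 * n + 3)) := by
    calc ((n : ℝ) + 2) * (n + 1) * n.factorial = n.factorial * ((n + 2) * (n + 1)) := by ring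
      _ ≤ u * ((n + 2) * (2 * n + 3)) := by gcongr <;> linarith
  calc (1 - s) * (((n : ℝ) + 2) * (n + 1) * n.factorial)
      ≤ (1 - s) * (u * ((n + 2) * (2 * n + 3))) := by gcongr
    _ = (1 - s) * u * ((n + 2) * (2 * n + 3)) := by ring

theorem div_exp_pow_le_factorial (ℓ : ℕ) : ((ℓ : ℝ) / Real.exp 1) ^ ℓ ≤ ℓ.factorial := by
  have h := Real.pow_div_factorial_le_exp (ℓ : ℝ) ℓ.cast_nonneg ℓ
  rw [div_pow, ← Real.exp_nat_mul, mul_one, div_le_iff₀ (Real.exp_pos _)]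
  rw [div_le_iff₀ (by positivity)] at h
  linarith

theorem factorial_le_relaxationTime (hℓ : 5 ≤ ℓ) :
    ENNReal.ofReal (ℓ.factorial : ℝ) ≤ relaxationTime (exP ℓ) := by
  have hpos : (0 : ℝ) < ℓ.factorial := by exact_mod_cast ℓ.factorial_pos
  rw [relaxationTime, one_div, ← ENNReal.inv_le_inv, inv_inv, ← ENNReal.ofReal_inv_of_pos hpos]
  refine ENNReal.ofReal_le_ofReal ?_
  rw [← one_div]
  exact one_sub_secondEigenvalue_exP_le hℓ

theorem relaxationTime_pos {α : Type*} [Fintype α] [DecidableEq α] (P : Matrix α α ℝ) :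
    0 < relaxationTime P := by
  rw [relaxationTime, one_div]
  exact ENNReal.inv_pos.mpr ENNReal.ofReal_ne_top

end Instances

end ReducedChain

theorem mainTheorem11 :
    (∀ ℓ : ℕ, 3 ≤ ℓ → Odd ℓ → (ReducedChain.exP ℓ).IsIrreducible) ∧
    ∃ C : ℝ, 0 < C ∧ ∀ ℓ : ℕ, 3 ≤ ℓ →
      ENNReal.ofReal (C * ((ℓ : ℝ) / Real.exp 1) ^ ℓ) ≤
        ReducedChain.relaxationTime (ReducedChain.exP ℓ) := by
  refine ⟨fun ℓ hℓ hodd => ReducedChain.exP_isIrreducible hℓ hodd, ?_⟩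
  -- For `ℓ = 3, 4` only positivity of the relaxation time is used; the minimum with `1` keeps `m`
  -- finite, and the `24` below is `4!`, which bounds `(ℓ/e)^ℓ` for both.
  let m : ℝ≥0∞ := min 1 (min (ReducedChain.relaxationTime (ReducedChain.exP 3))
    (ReducedChain.relaxationTime (ReducedChain.exP 4)))
  have hm1 : m ≤ 1 := min_le_left _ _
  have hm : m ≠ ⊤ := (hm1.trans_lt ENNReal.one_lt_top).ne
  have hm0 : 0 < m.toReal := ENNReal.toReal_pos
    (lt_min one_pos (lt_min (ReducedChain.relaxationTime_pos _)
      (ReducedChain.relaxationTime_pos _))).ne' hm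
  have hm1' : m.toReal ≤ 1 := ENNReal.toReal_le_of_le_ofReal zero_le_one (by simpa using hm1)
  refine ⟨m.toReal / 24, by positivity, fun ℓ hℓ => ?_⟩
  have hfac := ReducedChain.div_exp_pow_le_factorial ℓ
  by_cases h5 : 5 ≤ ℓ
  · refine le_trans (ENNReal.ofReal_le_ofReal ?_) (ReducedChain.factorial_le_relaxationTime h5)
    refine le_trans (mul_le_of_le_one_left (by positivity) ?_) hfac
    linarith
  · have h24 : (ℓ.factorial : ℝ) ≤ 24 := by
      exact_mod_cast Nat.factorial_le (show ℓ ≤ 4 by omega)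
    have hle : ENNReal.ofReal (m.toReal / 24 * ((ℓ : ℝ) / Real.exp 1) ^ ℓ) ≤ m := by
      rw [← ENNReal.ofReal_toReal hm]
      refine ENNReal.ofReal_le_ofReal ?_
      rw [ENNReal.toReal_ofReal hm0.le]
      calc m.toReal / 24 * ((ℓ : ℝ) / Real.exp 1) ^ ℓ ≤ m.toReal / 24 * 24 := by
            gcongr
            exact hfac.trans h24
        _ = m.toReal := by ring
    refine hle.trans ?_
    interval_cases ℓ
    · exact (min_le_right _ _).trans (min_le_left _ _)
    · exact (min_le_right _ _).trans (min_le_right _ _)
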